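/- All fields have characteristic $0$. Let $(\mathbb F,\sigma)$ be a difference field and let $(\mathbb F(x),\sigma)$ be a $\Pi\Sigma$-field extension of it: $\mathbb F(x)$ is the rational function field, $\sigma$ is an automorphism of $\mathbb F(x)$ extending that of $\mathbb F$, $\sigma(x)/x\in\mathbb F^*$ or $\sigma(x)-x\in\mathbb F$, and the constants (elements fixed by $\sigma$) of $\mathbb F(x)$ are those of $\mathbb F$. Put $\mathbb K=\{c\in\mathbb F:\sigma(c)=c\}$. A nonzero $h\in\mathbb F(x)$ has period $0$ if there is no $n>0$ with $\sigma^n(h)/h\in\mathbb F$. A nonzero element of $\mathbb F(x)$ has $x$-degree $\le d$ if every irreducible factor of period $0$ of its numerator and of its denominator has degree $\le d$. Let $d\in\mathbb N$ and let $Q=\{q_1,\dots,q_r\}\subseteq\mathbb F[x]$ (with $q_i$ pairwise distinct) be a $(d,x)$-set: the $q_i$ are monic and irreducible of degree $>d$ and of period $0$, and for $i\ne j$ there is no $k\in\mathbb Z$ with $\sigma^k(q_i)/q_j\in\mathbb F$. Let $(\mathbb E,\sigma)$ with $\mathbb E=\mathbb F(x)\langle t_1\rangle\cdots\langle t_e\rangle$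 be a simple $R\Pi\Sigma$-extension of $(\mathbb F(x),\sigma)$ with $x$-degree $\le d$. That is, $\sigma$ extends to an automorphism of $\mathbb E$, $\mathbb E$ has the same constants as $\mathbb F(x)$, and with $\mathbb E_0=\mathbb F(x)$, $\mathbb E_i=\mathbb E_{i-1}\langle t_i\rangle$, each $t_i$ is of one of three kinds: (R) $\mathbb E_i=\mathbb E_{i-1}[t_i]$ subject to the relation $t_i^\nu=1$ with some $\nu>1$, where $\sigma(t_i)/t_i\in\mathbb E_{i-1}^*$ is a primitive $\nu$-th root of unity; ($\Pi$) $\mathbb E_i=\mathbb E_{i-1}[t_i,t_i^{-1}]$ is a Laurent polynomial ring and $\sigma(t_i)/t_i\in\mathbb E_{i-1}^*$; ($\Sigma$) $\mathbb E_i=\mathbb E_{i-1}[t_i]$ is a polynomial ring and $\sigma(t_i)-t_i\in\mathbb E_{i-1}$. Simplicity means that for R- and $\Pi$-generators $\sigma(t_i)/t_i=u\,t_1^{m_1}\cdots t_{i-1}^{m_{i-1}}$ with $u\in\mathbb F(x)^*$, $m_j\in\mathbb Z$, and $m_j=0$ if $t_j$ is a $\Sigma$-generator; for R-generators, moreover,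 $u$ is a root of unity and $m_j=0$ if $t_j$ is a $\Pi$-generator. Every $f\in\mathbb E$ has unique coefficients in $\mathbb F(x)$ with respect to the power products $t_1^{n_1}\cdots t_e^{n_e}$ with $0\le n_i<\nu_i$ (R, of order $\nu_i$), $n_i\in\mathbb Z$ ($\Pi$), $n_i\ge0$ ($\Sigma$). Let $\operatorname{den}(f)\in\mathbb F[x]$ be the monic least common multiple of the denominators of these coefficients; let $\mathbb P\subseteq\mathbb E$ be the subring $\mathbb F[x]\langle t_1\rangle\cdots\langle t_e\rangle$ of those elements whose coefficients all lie in $\mathbb F[x]$, and for $p\in\mathbb P$ let $\deg_x(p)$ be the maximal degree of its coefficients ($-\infty$ for $p=0$). Finally, $x$-degree $\le d$ of the extension means that the above $u$ has $x$-degree $\le d$ for every $\Pi$-generator and $\operatorname{den}(\sigma(t_i)-t_i)$ has $x$-degree $\le d$ for every $\Sigma$-generator. Let $(\mathbb S,\sigma)$ be a $(d,x,Q)$-reduced extension: $\mathbb S=\mathbb E[s_{i,j}:1\le i\le r,\ 1\le j\le e_i]$ with $e_i\in\mathbb N$ (possibly $0$) is a polynomial ring over $\mathbb E$, $\sigma$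 extends to an automorphism of $\mathbb S$ with the same constants as $\mathbb E$, and $\sigma(s_{i,j})=s_{i,j}+p_{i,j}/q_i^{n_{i,j}}$ with $n_{i,j}\ge1$, $p_{i,j}\in\mathbb P\setminus\{0\}$ and $\deg_x(p_{i,j})<n_{i,j}\deg_x(q_i)$. Let $f,g,f'\in\mathbb E$ satisfy $f=\sigma(g)-g+f'$ where $$f'=\frac{p_1}{q_1^{n_1}}+\dots+\frac{p_r}{q_r^{n_r}}+\frac pq$$ with $n_i\ge1$, $q\in\mathbb F[x]\setminus\{0\}$ of $x$-degree $\le d$, $p,p_1,\dots,p_r\in\mathbb P$ and $\deg_x(p_i)<n_i\deg_x(q_i)$. Put $\mu_i=\max(n_i,n_{i,1},\dots,n_{i,e_i})$. Then there is an $h\in\mathbb S$ with $\sigma(h)-h=f$ if and only if both of the following hold: (a) for every $1\le i\le r$ there are $c_{i,1},\dots,c_{i,e_i}\in\mathbb K$ with $$q_i^{\mu_i-n_i}p_i=c_{i,1}q_i^{\mu_i-n_{i,1}}p_{i,1}+\dots+c_{i,e_i}q_i^{\mu_i-n_{i,e_i}}p_{i,e_i};$$ (b) there is a $g'\in\mathbb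 E$ with $\sigma(g')-g'=p/q$. Moreover, for all $c_{i,j}\in\mathbb K$ as in (a) and every $g'\in\mathbb E$ as in (b), $\operatorname{den}(g')$ has $x$-degree $\le d$, and $$h=g+g'+\sum_{i=1}^r\sum_{j=1}^{e_i}c_{i,j}s_{i,j}\in\mathbb S$$ satisfies $\sigma(h)-h=f$. -/

import Mathlib

open Polynomial

noncomputable section

/-! ## Difference fields and the field extension `F(x)` of `F` -/

section Field

variable {F : Type*} [Field F]

/-- The difference field `(F(x), σ)` is a ΠΣ-field extension of the difference field `(F, σ₀)`
with the single generator `x`: `F(x)` is the rational function field, `σ` extends `σ₀`,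
`σ(x)/x ∈ Fˣ` or `σ(x) - x ∈ F`, and no new constants arise. -/
structure IsPiSigmaFieldExt (σ₀ : RingAut F) (σ : RingAut (RatFunc F)) : Prop where
  map_C : ∀ a : F, σ (RatFunc.C a) = RatFunc.C (σ₀ a)
  monomial : (∃ a : F, a ≠ 0 ∧ σ RatFunc.X = RatFunc.C a * RatFunc.X) ∨
    (∃ b : F, σ RatFunc.X = RatFunc.X + RatFunc.C b)
  const : ∀ h : RatFunc F, σ h = h → ∃ c : F, h = RatFunc.C c

/-- The period of `h ∈ F(x)`: the smallest `n > 0` with `σⁿ(h)/h ∈ F`, and `0` if there is none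
(the infimum of the empty set of natural numbers is `0`). -/
def period (σ : RingAut (RatFunc F)) (h : RatFunc F) : ℕ :=
  sInf {n : ℕ | 0 < n ∧ ∃ c : F, (σ ^ n) h / h = RatFunc.C c}

/-- A polynomial has `x`-degree `≤ d` if each of its irreducible factors of period `0` has
degree `≤ d`. -/
def PolyXDegLE (σ : RingAut (RatFunc F)) (d : ℕ) (f : F[X]) : Prop :=
  ∀ v : F[X], Irreducible v → v ∣ f → period σ (algebraMap F[X] (RatFunc F) v) = 0 →
    v.natDegree ≤ d

/-- A rational function has `x`-degree `≤ d` if each irreducible factor of period `0` of its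
numerator or of its denominator has degree `≤ d`. -/
def RatXDegLE (σ : RingAut (RatFunc F)) (d : ℕ) (f : RatFunc F) : Prop :=
  PolyXDegLE σ d f.num ∧ PolyXDegLE σ d f.denom

/-- `σ`-equivalence of (irreducible) polynomials: `σᵏ(f)/g ∈ F` for some `k ∈ ℤ`. -/
def ShiftEquivalent (σ : RingAut (RatFunc F)) (f g : F[X]) : Prop :=
  ∃ k : ℤ, ∃ c : F,
    (σ ^ k) (algebraMap F[X] (RatFunc F) f) / algebraMap F[X] (RatFunc F) g = RatFunc.C c

/-- `(d, x)`-sets: finite sets of monic irreducible polynomials of degree `> d` and of period `0`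
that are pairwise `σ`-coprime. -/
structure IsDXSet (σ : RingAut (RatFunc F)) (d : ℕ) (Q : Set F[X]) : Prop where
  finite : Q.Finite
  monic : ∀ f ∈ Q, f.Monic
  irreducible : ∀ f ∈ Q, Irreducible f
  lt_natDegree : ∀ f ∈ Q, d < f.natDegree
  period_eq_zero : ∀ f ∈ Q, period σ (algebraMap F[X] (RatFunc F) f) = 0
  coprime : Q.Pairwise fun f g => ¬ ShiftEquivalent σ f g

end Field

/-! ## RΠΣ-extensions of difference rings -/

/-- The three kinds of generators: an R-monomial of order `ν`, a Π-monomial, a Σ-monomial. -/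
inductive MonomialKind where
  | root (ν : ℕ)
  | pi
  | sigma

/-- The reduced exponents of a generator: `0 ≤ n < ν` for an R-monomial of order `ν`,
all integers for a Π-monomial, `0 ≤ n` for a Σ-monomial. -/
def MonomialKind.Reduced : MonomialKind → ℤ → Prop
  | .root ν, n => 0 ≤ n ∧ n < ν
  | .pi, _ => True
  | .sigma, n => 0 ≤ n

/-- The power `tⁿ`, `n ∈ ℤ`, in a commutative ring. For `n < 0` it is meant for units `t`. -/
def intPow {E : Type*} [CommRing E] (t : E) (n : ℤ) : E :=
  t ^ n.toNat * Ring.inverse t ^ (-n).toNat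

/-- The power product `t₁^n₁ ⋯ tₑ^nₑ`. -/
def powProd {E : Type*} [CommRing E] {e : ℕ} (t : Fin e → E) (n : Fin e → ℤ) : E :=
  ∏ i, intPow (t i) (n i)

section Ring

variable {A : Type*} [CommRing A] {E : Type*} [CommRing E] [Algebra A E] {e : ℕ}

/-- The ring `A⟨t₁⟩⋯⟨tₖ⟩` generated over `A` by the first `k` generators, together with the
inverses of the Π-monomials among them. -/
def stage (A : Type*) [CommRing A] {E : Type*} [CommRing E] [Algebra A E] {e : ℕ}
    (kind : Fin e → MonomialKind) (t : Fin e → E) (k : ℕ) : Subalgebra A E :=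
  Algebra.adjoin A {y | ∃ j : Fin e, (j : ℕ) < k ∧
    (y = t j ∨ (kind j = MonomialKind.pi ∧ y = Ring.inverse (t j)))}

/-- The difference ring `(E, σE)` is an RΠΣ-extension of the difference ring `(A, σA)` with
`E = A⟨t₁⟩⋯⟨tₑ⟩`. The field `free` says that the powers of `tᵢ` with reduced exponents are linearly
independent over the preceding ring `Aᵢ₋₁ = A⟨t₁⟩⋯⟨tᵢ₋₁⟩`. So `Aᵢ` is the polynomial ring `Aᵢ₋₁[tᵢ]`
for a Σ-monomial, the Laurent polynomial ring `Aᵢ₋₁[tᵢ, tᵢ⁻¹]` for a Π-monomial and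
`Aᵢ₋₁[tᵢ]` with the single relation `tᵢ^ν = 1` for an R-monomial. -/
structure IsRPiSigmaExt (σA : RingAut A) (σE : RingAut E)
    (kind : Fin e → MonomialKind) (t : Fin e → E) : Prop where
  injective : Function.Injective (algebraMap A E)
  map_algebraMap : ∀ a : A, σE (algebraMap A E a) = algebraMap A E (σA a)
  generates : stage A kind t e = ⊤
  free : ∀ i : Fin e, LinearIndependent (stage A kind t i)
    (fun n : {n : ℤ // (kind i).Reduced n} => intPow (t i) (n : ℤ))
  root : ∀ (i : Fin e) (ν : ℕ), kind i = MonomialKind.root ν → 1 < ν ∧ t i ^ ν = 1 ∧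
    ∃ α : (stage A kind t i)ˣ, IsPrimitiveRoot (α : stage A kind t i) ν ∧
      σE (t i) = ((α : stage A kind t i) : E) * t i
  pi : ∀ i : Fin e, kind i = MonomialKind.pi → IsUnit (t i) ∧
    ∃ α : (stage A kind t i)ˣ, σE (t i) = ((α : stage A kind t i) : E) * t i
  sigma : ∀ i : Fin e, kind i = MonomialKind.sigma → σE (t i) - t i ∈ stage A kind t i
  const : ∀ y : E, σE y = y → ∃ a : A, y = algebraMap A E a

/-- `σ(tᵢ)/tᵢ = u · t₁^m₁ ⋯ tᵢ₋₁^mᵢ₋₁` with `u ∈ Aˣ` and `mⱼ = 0` if `tⱼ` is a Σ-monomial. -/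
def IsSimpleQuotient (σE : RingAut E) (kind : Fin e → MonomialKind) (t : Fin e → E)
    (i : Fin e) (u : A) (m : Fin e → ℤ) : Prop :=
  IsUnit u ∧ (∀ j, i ≤ j → m j = 0) ∧ (∀ j, kind j = MonomialKind.sigma → m j = 0) ∧
    σE (t i) = algebraMap A E u * powProd t m * t i

/-- The condition on the R- and the Π-monomials that makes an RΠΣ-extension of `A` simple. -/
structure IsSimpleExt (A : Type*) [CommRing A] {E : Type*} [CommRing E] [Algebra A E] {e : ℕ}
    (σE : RingAut E) (kind : Fin e → MonomialKind) (t : Fin e → E) : Prop where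
  pi : ∀ i, kind i = MonomialKind.pi → ∃ (u : A) (m : Fin e → ℤ), IsSimpleQuotient σE kind t i u m
  root : ∀ i ν, kind i = MonomialKind.root ν → ∃ (u : A) (m : Fin e → ℤ),
    IsSimpleQuotient σE kind t i u m ∧ (∃ k : ℕ, 0 < k ∧ u ^ k = 1) ∧
      ∀ j, kind j = MonomialKind.pi → m j = 0

/-- `f = ∑ cₙ tⁿ`, the sum being over finitely many reduced exponent vectors `n`. -/
def IsExpansion (kind : Fin e → MonomialKind) (t : Fin e → E) (f : E)
    (c : (Fin e → ℤ) →₀ A) : Prop :=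
  (∀ n ∈ c.support, ∀ i, (kind i).Reduced (n i)) ∧ (c.sum fun n a => a • powProd t n) = f

open Classical in
/-- The coefficients of `f ∈ A⟨t₁⟩⋯⟨tₑ⟩` with respect to the reduced power products. In an
RΠΣ-extension they exist and are unique, see `IsRPiSigmaExt.existsUnique_expansion`. -/
def powCoeffs (A : Type*) [CommRing A] {E : Type*} [CommRing E] [Algebra A E] {e : ℕ}
    (kind : Fin e → MonomialKind) (t : Fin e → E) (f : E) : (Fin e → ℤ) →₀ A :=
  if h : ∃ c : (Fin e → ℤ) →₀ A, IsExpansion kind t f c then h.choose else 0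

theorem intPow_zero (y : E) : intPow y 0 = 1 := by simp [intPow]

theorem intPow_mul_inverse {y : E} (hy : IsUnit y) (n : ℤ) :
    intPow y n * Ring.inverse y = intPow y (n - 1) := by
  have hc : y * Ring.inverse y = 1 := Ring.mul_inverse_cancel y hy
  unfold intPow
  rcases le_or_gt n 0 with h | h
  · have h1 : n.toNat = 0 := by omega
    have h2 : (n - 1).toNat = 0 := by omega
    have h3 : (-(n - 1)).toNat = (-n).toNat + 1 := by omega
    rw [h1, h2, h3]; ring
  · obtain ⟨k, rfl⟩ : ∃ k : ℕ, n = k + 1 := ⟨(n - 1).toNat, by omega⟩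
    have h1 : ((k : ℤ) + 1).toNat = k + 1 := by omega
    have h2 : ((k : ℤ) + 1 - 1).toNat = k := by omega
    have h3 : (-((k : ℤ) + 1)).toNat = 0 := by omega
    have h4 : (-((k : ℤ) + 1 - 1)).toNat = 0 := by omega
    rw [h1, h2, h3, h4]
    linear_combination y ^ k * hc

theorem intPow_mul_self {y : E} {n : ℤ} (h : IsUnit y ∨ 0 ≤ n) :
    intPow y n * y = intPow y (n + 1) := by
  rcases le_or_gt 0 n with hn | hn
  · obtain ⟨k, rfl⟩ := Int.eq_ofNat_of_zero_le hn
    have h1 : ((k : ℤ) + 1).toNat = k + 1 := by omega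
    have h2 : (-((k : ℤ) + 1)).toNat = 0 := by omega
    have h3 : (-(k : ℤ)).toNat = 0 := by omega
    unfold intPow
    rw [h1, h2, h3, Int.toNat_natCast]; ring
  · have hy := h.resolve_right (by omega)
    have := intPow_mul_inverse hy (n + 1)
    rw [add_sub_cancel_right] at this
    rw [← this, mul_assoc, Ring.inverse_mul_cancel y hy, mul_one]

theorem powProd_update (t : Fin e → E) (n : Fin e → ℤ) (i : Fin e) (k : ℤ) :
    powProd t (Function.update n i k) = powProd t (Function.update n i 0) * intPow (t i) k := by
  unfold powProd
  rw [← Finset.mul_prod_erase _ _ (Finset.mem_univ i),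
    ← Finset.mul_prod_erase _ (fun j => intPow (t j) (Function.update n i 0 j))
      (Finset.mem_univ i)]
  simp only [Function.update_self, intPow_zero, one_mul]
  rw [mul_comm]
  congr 1
  apply Finset.prod_congr rfl
  intro j hj
  rw [Function.update_of_ne (Finset.ne_of_mem_erase hj),
    Function.update_of_ne (Finset.ne_of_mem_erase hj)]

theorem IsRPiSigmaExt.exists_mul_self {σA : RingAut A} {σE : RingAut E}
    {kind : Fin e → MonomialKind} {t : Fin e → E} (h : IsRPiSigmaExt σA σE kind t)
    (i : Fin e) {k : ℤ} (hk : (kind i).Reduced k) :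
    ∃ k', (kind i).Reduced k' ∧ intPow (t i) k * t i = intPow (t i) k' := by
  cases hi : kind i with
  | pi => exact ⟨k + 1, trivial, intPow_mul_self (Or.inl (h.pi i hi).1)⟩
  | sigma =>
    rw [hi] at hk
    exact ⟨k + 1, Int.add_nonneg hk zero_le_one, intPow_mul_self (Or.inr hk)⟩
  | root ν =>
    rw [hi] at hk
    obtain ⟨h0, h1⟩ := hk
    obtain ⟨hν, hroot, -⟩ := h.root i ν hi
    rw [intPow_mul_self (Or.inr h0)]
    by_cases hlt : k + 1 < ν
    · exact ⟨k + 1, ⟨by omega, hlt⟩, rfl⟩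
    · have : k + 1 = ν := by omega
      refine ⟨0, ⟨le_rfl, by omega⟩, ?_⟩
      rw [this]
      simp [intPow, hroot]

/-- In an RΠΣ-extension the reduced power products span the ring. -/
theorem IsRPiSigmaExt.span_eq_top {σA : RingAut A} {σE : RingAut E}
    {kind : Fin e → MonomialKind} {t : Fin e → E} (h : IsRPiSigmaExt σA σE kind t) :
    Submodule.span A {y | ∃ n : Fin e → ℤ, (∀ i, (kind i).Reduced (n i)) ∧ y = powProd t n} =
      ⊤ := by
  set N := Submodule.span A
    {y | ∃ n : Fin e → ℤ, (∀ i, (kind i).Reduced (n i)) ∧ y = powProd t n} with hN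
  have key : ∀ (i : Fin e) (z : E), (∀ k, (kind i).Reduced k → ∃ k', (kind i).Reduced k' ∧
      intPow (t i) k * z = intPow (t i) k') → ∀ y ∈ N, y * z ∈ N := by
    intro i z hz y hy
    induction hy using Submodule.span_induction with
    | mem y hy =>
      obtain ⟨n, hn, rfl⟩ := hy
      obtain ⟨k', hk', he⟩ := hz (n i) (hn i)
      apply Submodule.subset_span
      refine ⟨Function.update n i k', ?_, ?_⟩
      · intro j
        by_cases hj : j = i
        · subst hj; simpa using hk'
        · simpa [hj] using hn j
      · rw [powProd_update, ← he]
        conv_lhs => rw [← Function.update_eq_self i n, powProd_update]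
        ring
    | zero => simp
    | add a b _ _ ha hb => rw [add_mul]; exact N.add_mem ha hb
    | smul a y _ ha => rw [smul_mul_assoc]; exact N.smul_mem _ ha
  have hmul : ∀ x ∈ stage A kind t e, ∀ y ∈ N, y * x ∈ N := by
    intro x hx
    refine Algebra.adjoin_induction (p := fun x _ => ∀ y ∈ N, y * x ∈ N) ?_ ?_ ?_ ?_ hx
    · rintro x ⟨j, -, rfl | ⟨hj, rfl⟩⟩
      · exact key j _ fun k hk => h.exists_mul_self j hk
      · refine key j _ fun k _ => ⟨k - 1, ?_, intPow_mul_inverse (h.pi j hj).1 k⟩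
        rw [hj]; trivial
    · intro a y hy
      rw [mul_comm, ← Algebra.smul_def]; exact N.smul_mem _ hy
    · intro a b _ _ ha hb y hy
      rw [mul_add]; exact N.add_mem (ha y hy) (hb y hy)
    · intro a b _ _ ha hb y hy
      rw [← mul_assoc]; exact hb _ (ha y hy)
  rw [eq_top_iff]
  intro x _
  have h1 : (1 : E) ∈ N := by
    apply Submodule.subset_span
    refine ⟨0, fun i => ?_, by simp [powProd, intPow_zero]⟩
    cases hi : kind i with
    | pi => trivial
    | sigma => exact le_refl (0 : ℤ)
    | root ν =>
      have := (h.root i ν hi).1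
      exact ⟨le_rfl, by simp; omega⟩
  have := hmul x (by rw [h.generates]; trivial) 1 h1
  rwa [one_mul] at this

theorem powProd_mem_stage {kind : Fin e → MonomialKind} {t : Fin e → E} {k : ℕ}
    {n : Fin e → ℤ} (hn : ∀ i, (kind i).Reduced (n i)) (h0 : ∀ i : Fin e, k ≤ i → n i = 0) :
    powProd t n ∈ stage A kind t k := by
  refine Subalgebra.prod_mem _ fun i _ => ?_
  by_cases hi : k ≤ i
  · rw [h0 i hi, intPow_zero]; exact one_mem _
  · have ht : t i ∈ stage A kind t k :=
      Algebra.subset_adjoin ⟨i, by omega, Or.inl rfl⟩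
    unfold intPow
    refine mul_mem (pow_mem ht _) ?_
    have hi' := hn i
    cases hk : kind i with
    | pi =>
      have hu : Ring.inverse (t i) ∈ stage A kind t k :=
        Algebra.subset_adjoin ⟨i, by omega, Or.inr ⟨hk, rfl⟩⟩
      exact pow_mem hu _
    | sigma =>
      rw [hk] at hi'
      have : (-(n i)).toNat = 0 := by have : 0 ≤ n i := hi'; omega
      rw [this, pow_zero]; exact one_mem _
    | root ν =>
      rw [hk] at hi'
      have : (-(n i)).toNat = 0 := by have : 0 ≤ n i := hi'.1; omega
      rw [this, pow_zero]; exact one_mem _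

theorem IsRPiSigmaExt.linearIndependent_aux {σA : RingAut A} {σE : RingAut E}
    {kind : Fin e → MonomialKind} {t : Fin e → E} (h : IsRPiSigmaExt σA σE kind t) (k : ℕ)
    (hk : k ≤ e) : LinearIndependent A
      (fun n : {n : Fin e → ℤ // (∀ i, (kind i).Reduced (n i)) ∧ ∀ i : Fin e, k ≤ i → n i = 0} =>
        powProd t n.1) := by
  induction k with
  | zero =>
    have hs : ∀ n : {n : Fin e → ℤ // (∀ i, (kind i).Reduced (n i)) ∧
        ∀ i : Fin e, 0 ≤ (i : ℕ) → n i = 0}, n.1 = 0 := fun n => by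
      ext i; exact n.2.2 i (Nat.zero_le _)
    have : Subsingleton {n : Fin e → ℤ // (∀ i, (kind i).Reduced (n i)) ∧
        ∀ i : Fin e, 0 ≤ (i : ℕ) → n i = 0} :=
      ⟨fun a b => Subtype.ext ((hs a).trans (hs b).symm)⟩
    rw [linearIndependent_iff]
    intro c hc
    ext n
    have hcn : c = Finsupp.single n (c n) := by
      ext j; rw [Subsingleton.elim j n, Finsupp.single_eq_same]
    rw [hcn, Finsupp.linearCombination_single, hs n] at hc
    have h1 : powProd t 0 = (1 : E) := by simp [powProd, intPow_zero]
    rw [h1, ← Algebra.algebraMap_eq_smul_one, ← map_zero (algebraMap A E)] at hc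
    exact h.injective hc
  | succ k ih =>
    have ih := ih (by omega)
    let i : Fin e := ⟨k, hk⟩
    let b : {n : Fin e → ℤ // (∀ i, (kind i).Reduced (n i)) ∧ ∀ i : Fin e, k ≤ i → n i = 0} →
        stage A kind t i := fun n => ⟨powProd t n.1, powProd_mem_stage n.2.1 n.2.2⟩
    have hb : LinearIndependent A b :=
      LinearIndependent.of_comp (stage A kind t i).val.toLinearMap ih
    have hprod := linearIndependent_smul hb (h.free i)
    have hz : (kind i).Reduced 0 := by
      cases hi : kind i with
      | pi => trivial
      | sigma => exact le_refl (0 : ℤ)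
      | root ν =>
        have := (h.root i ν hi).1
        exact ⟨le_rfl, by simp; omega⟩
    let φ : {n : Fin e → ℤ // (∀ i, (kind i).Reduced (n i)) ∧
          ∀ i : Fin e, k + 1 ≤ i → n i = 0} →
        {n : Fin e → ℤ // (∀ i, (kind i).Reduced (n i)) ∧ ∀ i : Fin e, k ≤ i → n i = 0} ×
          {n : ℤ // (kind i).Reduced n} := fun n =>
      (⟨Function.update n.1 i 0, by
          intro j
          by_cases hj : j = i
          · subst hj; simpa using hz
          · simpa [hj] using n.2.1 j, by
          intro j hj
          by_cases hji : j = i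
          · subst hji; simp
          · have : (j : ℕ) ≠ k := fun hh => hji (Fin.ext hh)
            simpa [hji] using n.2.2 j (by omega)⟩, ⟨n.1 i, n.2.1 i⟩)
    have hφ : Function.Injective φ := by
      intro n n' hnn
      have h1 : Function.update n.1 i 0 = Function.update n'.1 i 0 :=
        congrArg (fun z => z.1.1) hnn
      have h2 : n.1 i = n'.1 i := congrArg (fun z => z.2.1) hnn
      apply Subtype.ext
      rw [← Function.update_eq_self i n.1, ← Function.update_eq_self i n'.1,
        ← Function.update_idem (f := n.1) (v := (0 : ℤ)),
        ← Function.update_idem (f := n'.1) (v := (0 : ℤ)), h1, h2]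
    convert! hprod.comp φ hφ using 1
    ext n
    simp only [Function.comp, φ, b]
    rw [Subalgebra.smul_def, smul_eq_mul, ← powProd_update, Function.update_eq_self]

/-- In an RΠΣ-extension `A⟨t₁⟩⋯⟨tₑ⟩` the coefficients with respect to the reduced power products
exist and are unique. -/
theorem IsRPiSigmaExt.existsUnique_expansion {σA : RingAut A} {σE : RingAut E}
    {kind : Fin e → MonomialKind} {t : Fin e → E} (h : IsRPiSigmaExt σA σE kind t) (f : E) :
    ∃! c : (Fin e → ℤ) →₀ A, IsExpansion kind t f c := by
  have hli : LinearIndepOn A (powProd t) {n : Fin e → ℤ | ∀ i, (kind i).Reduced (n i)} := by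
    have h1 := h.linearIndependent_aux e le_rfl
    let φ : {n : Fin e → ℤ | ∀ i, (kind i).Reduced (n i)} →
        {n : Fin e → ℤ // (∀ i, (kind i).Reduced (n i)) ∧ ∀ i : Fin e, e ≤ i → n i = 0} :=
      fun n => ⟨n.1, n.2, fun i hi => absurd i.2 (by omega)⟩
    exact h1.comp φ fun n n' hn => Subtype.ext (congrArg (fun z => z.1) hn)
  have hex : ∃ c : (Fin e → ℤ) →₀ A, IsExpansion kind t f c := by
    have hf : f ∈ Submodule.span A
        (powProd t '' {n : Fin e → ℤ | ∀ i, (kind i).Reduced (n i)}) := by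
      have : powProd t '' {n : Fin e → ℤ | ∀ i, (kind i).Reduced (n i)} =
          {y | ∃ n : Fin e → ℤ, (∀ i, (kind i).Reduced (n i)) ∧ y = powProd t n} := by
        ext y; simp only [Set.mem_image, Set.mem_ofPred_eq, eq_comm]
      rw [this, h.span_eq_top]; trivial
    obtain ⟨c, hc, hcf⟩ := (Finsupp.mem_span_image_iff_linearCombination A).mp hf
    exact ⟨c, fun n hn => (Finsupp.mem_supported A c).mp hc hn, hcf⟩
  obtain ⟨c, hc⟩ := hex
  refine ⟨c, hc, fun c' hc' => ?_⟩
  exact linearIndepOn_iffₛ.mp hli c' ((Finsupp.mem_supported A c').mpr hc'.1) c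
    ((Finsupp.mem_supported A c).mpr hc.1) (hc'.2.trans hc.2.symm)

theorem IsRPiSigmaExt.isExpansion_powCoeffs {σA : RingAut A} {σE : RingAut E}
    {kind : Fin e → MonomialKind} {t : Fin e → E} (h : IsRPiSigmaExt σA σE kind t) (f : E) :
    IsExpansion kind t f (powCoeffs A kind t f) := by
  have hex := (h.existsUnique_expansion f).exists
  rw [powCoeffs, dif_pos hex]
  exact hex.choose_spec

end Ring

/-! ## Elements of an RΠΣ-extension of `F(x)` -/

section Elements

variable {F : Type*} [Field F] {E : Type*} [CommRing E] [Algebra (RatFunc F) E] {e : ℕ}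

/-- The denominator `den(f)`: the monic least common multiple of the denominators of the
coefficients of `f`, that is, the monic generator of the ideal of their common multiples. -/
def den (kind : Fin e → MonomialKind) (t : Fin e → E) (f : E) : F[X] :=
  let w : F[X] := Submodule.IsPrincipal.generator
    (⨅ n : Fin e → ℤ, Ideal.span {(powCoeffs (RatFunc F) kind t f n).denom})
  C w.leadingCoeff⁻¹ * w

theorem den_monic (kind : Fin e → MonomialKind) (t : Fin e → E) (f : E) :
    (den (F := F) kind t f).Monic := by
  rw [den, mul_comm]
  apply monic_mul_leadingCoeff_inv
  rw [Ne, ← Submodule.IsPrincipal.eq_bot_iff_generator_eq_zero]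
  intro h
  have h1 : (∏ n ∈ (powCoeffs (RatFunc F) kind t f).support,
      (powCoeffs (RatFunc F) kind t f n).denom) ∈
      (⨅ n : Fin e → ℤ, Ideal.span {(powCoeffs (RatFunc F) kind t f n).denom}) := by
    rw [Submodule.mem_iInf]
    intro n
    rw [Ideal.mem_span_singleton]
    by_cases hn : n ∈ (powCoeffs (RatFunc F) kind t f).support
    · exact Finset.dvd_prod_of_mem _ hn
    · rw [Finsupp.notMem_support_iff.mp hn, RatFunc.denom_zero]
      exact one_dvd _
  rw [h, Submodule.mem_bot, Finset.prod_eq_zero_iff] at h1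
  obtain ⟨n, -, hn⟩ := h1
  exact RatFunc.denom_ne_zero _ hn

theorem den_dvd_iff (kind : Fin e → MonomialKind) (t : Fin e → E) (f : E) (v : F[X]) :
    den kind t f ∣ v ↔ ∀ n, (powCoeffs (RatFunc F) kind t f n).denom ∣ v := by
  have h0 : IsUnit (C (Submodule.IsPrincipal.generator
      (⨅ n : Fin e → ℤ, Ideal.span {(powCoeffs (RatFunc F) kind t f n).denom})).leadingCoeff⁻¹) := by
    rw [isUnit_C]
    have := left_ne_zero_of_mul (den_monic (F := F) kind t f).ne_zero
    exact (C_ne_zero.mp this).isUnit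
  rw [den, h0.mul_left_dvd, ← Submodule.IsPrincipal.mem_iff_generator_dvd, Submodule.mem_iInf]
  simp only [Ideal.mem_span_singleton]

/-- The subring `F[x]⟨t₁⟩⋯⟨tₑ⟩` of `F(x)⟨t₁⟩⋯⟨tₑ⟩`: all coefficients are polynomials. -/
def IsPolyElem (F : Type*) [Field F] {E : Type*} [CommRing E] [Algebra (RatFunc F) E] {e : ℕ}
    (kind : Fin e → MonomialKind) (t : Fin e → E) (f : E) : Prop :=
  ∀ n, powCoeffs (RatFunc F) kind t f n ∈ (algebraMap F[X] (RatFunc F)).range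

/-- The degree in `x` of an element of `F[x]⟨t₁⟩⋯⟨tₑ⟩` (`⊥` for the element `0`). -/
def xDegree (F : Type*) [Field F] {E : Type*} [CommRing E] [Algebra (RatFunc F) E] {e : ℕ}
    (kind : Fin e → MonomialKind) (t : Fin e → E) (f : E) : WithBot ℕ :=
  (powCoeffs (RatFunc F) kind t f).support.sup fun n => (powCoeffs (RatFunc F) kind t f n).num.degree

/-- The quotient `a/b` for `a ∈ E` and a polynomial `b ≠ 0`. -/
def polyDiv (a : E) (b : F[X]) : E := (algebraMap F[X] (RatFunc F) b)⁻¹ • a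

/-- A simple RΠΣ-extension `E = F(x)⟨t₁⟩⋯⟨tₑ⟩` of `F(x)` has `x`-degree `≤ d`. -/
structure ExtXDegLE (σ : RingAut (RatFunc F)) (σE : RingAut E) (d : ℕ)
    (kind : Fin e → MonomialKind) (t : Fin e → E) : Prop where
  pi : ∀ i, kind i = MonomialKind.pi → ∃ (u : RatFunc F) (m : Fin e → ℤ),
    IsSimpleQuotient σE kind t i u m ∧ RatXDegLE σ d u
  sigma : ∀ i, kind i = MonomialKind.sigma →
    PolyXDegLE σ d (den (F := F) kind t (σE (t i) - t i))

/-- The `σ`-reduced form `f' = p₁/q₁^n₁ + ⋯ + pᵣ/qᵣ^nᵣ + a/b` with `nᵢ ≥ 1`, `b ∈ F[x] ∖ {0}` of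
`x`-degree `≤ d`, `a, pᵢ ∈ F[x]⟨t₁⟩⋯⟨tₑ⟩` and `deg_x(pᵢ) < deg_x(qᵢ) nᵢ`. -/
structure IsSigmaReducedForm (σ : RingAut (RatFunc F)) (d : ℕ)
    (kind : Fin e → MonomialKind) (t : Fin e → E) {r : ℕ} (q : Fin r → F[X]) (f' : E)
    (n : Fin r → ℕ) (p : Fin r → E) (a : E) (b : F[X]) : Prop where
  eq : f' = (∑ i, polyDiv (p i) (q i ^ n i)) + polyDiv a b
  pos : ∀ i, 1 ≤ n i
  ne_zero : b ≠ 0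
  xDegLE : PolyXDegLE σ d b
  isPolyElem : IsPolyElem F kind t a
  isPolyElem_p : ∀ i, IsPolyElem F kind t (p i)
  degree_lt : ∀ i, xDegree F kind t (p i) < ((q i).natDegree * n i : ℕ)

/-- The difference ring `(S, σS)` is a Σ-extension of `(E, σE)` with finitely many generators
`s j` all of whose increments `σ(s j) - s j` lie in `E`: `S` is the polynomial ring over `E`
in the `s j`, `σS` extends `σE`, and no new constants arise. -/
structure IsSigmaExt {S : Type*} [CommRing S] [Algebra E S] (σE : RingAut E) (σS : RingAut S)
    {J : Type*} (s : J → S) : Prop where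
  algebraicIndependent : AlgebraicIndependent E s
  generates : Algebra.adjoin E (Set.range s) = ⊤
  map_algebraMap : ∀ a : E, σS (algebraMap E S a) = algebraMap E S (σE a)
  sigma : ∀ j, ∃ b : E, σS (s j) - s j = algebraMap E S b
  const : ∀ y : S, σS y = y → ∃ a : E, y = algebraMap E S a

/-- The difference ring `(S, σS)` is a `(d, x, Q)`-reduced RΠΣ-extension of `(F(x), σ)` with
`Q = {q₁, …, qᵣ}`, `S = E[s₁₁, …, s₁ₗ₁, …, sᵣ₁, …, sᵣₗᵣ]` and `E = F(x)⟨t₁⟩⋯⟨tₑ⟩`, where the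
`s i j` are the `Q`-contributions, with `σ(s i j) = s i j + p i j / (q i)^(n i j)`. -/
structure IsReducedExt {S : Type*} [CommRing S] [Algebra E S] (σ : RingAut (RatFunc F))
    (σE : RingAut E) (σS : RingAut S) (d : ℕ) (kind : Fin e → MonomialKind) (t : Fin e → E)
    {r : ℕ} (q : Fin r → F[X]) (l : Fin r → ℕ) (n : ∀ i, Fin (l i) → ℕ)
    (p : ∀ i, Fin (l i) → E) (s : ∀ i, Fin (l i) → S) : Prop where
  isRPiSigmaExt : IsRPiSigmaExt σ σE kind t
  isSimpleExt : IsSimpleExt (RatFunc F) σE kind t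
  extXDegLE : ExtXDegLE σ σE d kind t
  isSigmaExt : IsSigmaExt σE σS fun j : (Σ i, Fin (l i)) => s j.1 j.2
  map_s : ∀ i j, σS (s i j) = s i j + algebraMap E S (polyDiv (p i j) (q i ^ n i j))
  pos : ∀ i j, 1 ≤ n i j
  ne_zero : ∀ i j, p i j ≠ 0
  isPolyElem : ∀ i j, IsPolyElem F kind t (p i j)
  degree_lt : ∀ i j, xDegree F kind t (p i j) < (n i j * (q i).natDegree : ℕ)

end Elements

end

/-! Suppose `h` in `S` has difference `f` in `E`. On the polynomial ring `S = E[s]`, `σ` translates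
the variables by elements of `E`, so it commutes with every partial derivative. Hence each partial
derivative of `h` is a constant, and in characteristic 0 `h` is a constant-coefficient combination
of the `s i j` plus some `w` in `E` (`IsSigmaExt.exists_eq_sum`). Constants of `E` lie in `F`. With
`v = w - g`, the equation becomes `σ(v) - v = ∑ R i / q i ^ μ i + a / b`, where `R i` is the
difference of the two sides of (a). It remains to show `R i = 0`.

This is an argument on poles at primes `p` of period 0 and degree `> d`. Such primes do not
interfere with the tower: each `σ(tᵢ)/tᵢ` is a unit over the local ring at `p`, and each increment
`σ(tᵢ) - tᵢ` is regular there. So `σ` carries poles at `p` exactly to poles at `σ(p)`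
(`IsRPiSigmaExt.regularAt_map_iff`). If `v` had poles along the orbit of `p`, there would be
finitely many; beyond the last one, and at the first one, `σ(v) - v` has a pole that cannot cancel,
which gives two distinct poles in one orbit (`IsRPiSigmaExt.regularAt_of_orbit`). But the right-hand
side has such poles only at associates of the `q i`, at most one per orbit. So `v` and `σ(v)` have
no such poles, `R i / q i ^ μ i` is regular at `q i`, and the degree bound on `R i` forces `R i = 0`
(`IsRPiSigmaExt.regularAt_and_eq_zero_of_sub_eq`). This is (a), and `v` then serves as `g'`. The
same lemma with `R = 0` bounds the denominator of every `g'`; the converse is a direct computation.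
-/

section SigmaExtension

/-! ### Differences in a Σ-extension, by partial derivatives -/

variable {E S : Type*} [CommRing E] [CommRing S] [Algebra E S] {J : Type*}

/-- The shifts `b i` are free of the variables, so the chain rule contributes only factors 0 and 1.
-/
theorem MvPolynomial.pderiv_shift {R : Type*} [CommRing R] (φ : R →+* R) (b : J → R) (j : J)
    (P : MvPolynomial J R) :
    MvPolynomial.pderiv j
        (MvPolynomial.eval₂Hom (MvPolynomial.C.comp φ)
          (fun i => MvPolynomial.X i + MvPolynomial.C (b i)) P) =
      MvPolynomial.eval₂Hom (MvPolynomial.C.comp φ)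
        (fun i => MvPolynomial.X i + MvPolynomial.C (b i)) (MvPolynomial.pderiv j P) := by
  classical
  induction P using MvPolynomial.induction_on with
  | C a => simp
  | add p q hp hq => simp only [map_add, hp, hq]
  | mul_X p i hp =>
    simp only [map_mul, MvPolynomial.pderiv_mul, hp, map_add, MvPolynomial.pderiv_C,
      MvPolynomial.pderiv_X, MvPolynomial.eval₂Hom_X', add_zero]
    by_cases h : i = j
    · subst h; simp
    · simp [h]

/-- A coefficient at `n` with `n j ≠ 0` reappears in the `j`-th derivative multiplied by `n j`. The
ring may have zero divisors (R-monomials produce them), so it is a `ℚ`-algebra structure that makes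
`n j` invertible. -/
theorem MvPolynomial.eq_C_of_pderiv_eq_zero {R : Type*} [CommRing R] [Algebra ℚ R]
    {P : MvPolynomial J R} (h : ∀ j, MvPolynomial.pderiv j P = 0) :
    P = MvPolynomial.C (P.coeff 0) := by
  classical
  ext n
  rw [MvPolynomial.coeff_C]
  split_ifs with hn
  · rw [hn]
  · obtain ⟨j, hj⟩ : ∃ j, n j ≠ 0 := by
      by_contra! hc
      exact hn (Finsupp.ext fun j => (hc j).symm)
    have h1 := congrArg (MvPolynomial.coeff (n - Finsupp.single j 1)) (h j)
    have h2 : n - Finsupp.single j 1 + Finsupp.single j 1 = n :=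
      tsub_add_cancel_of_le (Finsupp.single_le_iff.mpr (by omega))
    rw [MvPolynomial.coeff_pderiv, h2, MvPolynomial.coeff_zero] at h1
    have h3 : ((n - Finsupp.single j 1 : J →₀ ℕ) j : R) + 1 = algebraMap ℚ R (n j : ℚ) := by
      have : (n - Finsupp.single j 1 : J →₀ ℕ) j + 1 = n j := by
        simp only [Finsupp.coe_tsub, Pi.sub_apply, Finsupp.single_eq_same]; omega
      rw [← this]; simp
    have h4 : IsUnit (algebraMap ℚ R (n j : ℚ)) :=
      (IsUnit.mk0 _ (Nat.cast_ne_zero.mpr hj)).map _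
    rw [h3] at h1
    exact h4.mul_left_eq_zero.mp h1

/-- An element of a Σ-extension whose difference lies in the base ring is a linear combination
of the generators with constant coefficients plus an element of the base ring. -/
theorem IsSigmaExt.exists_eq_sum [Algebra ℚ E] [Fintype J] {σE : RingAut E} {σS : RingAut S}
    {s : J → S} (hS : IsSigmaExt σE σS s) {h : S} {f : E}
    (hf : σS h - h = algebraMap E S f) :
    ∃ (c : J → E) (w : E), (∀ j, σE (c j) = c j) ∧
      h = (∑ j, algebraMap E S (c j) * s j) + algebraMap E S w := by
  classical
  have hinj : Function.Injective (algebraMap E S) := hS.algebraicIndependent.algebraMap_injective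
  choose b hb using hS.sigma
  -- `Φ` is `σS` transported to the polynomial ring over `E`, where `pderiv` is available.
  set Φ := MvPolynomial.eval₂Hom (MvPolynomial.C.comp (σE : E →+* E))
    (fun i => MvPolynomial.X i + MvPolynomial.C (b i)) with hΦ
  have hΦS : ∀ P, MvPolynomial.aeval s (Φ P) = σS (MvPolynomial.aeval s P) := by
    intro P
    induction P using MvPolynomial.induction_on with
    | C a => simp [hΦ, hS.map_algebraMap]
    | add p q hp hq => simp only [map_add, hp, hq]
    | mul_X p i hp =>
      rw [map_mul, map_mul, hp, map_mul, map_mul]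
      congr 1
      rw [hΦ, MvPolynomial.eval₂Hom_X', map_add, MvPolynomial.aeval_X, MvPolynomial.aeval_C,
        ← hb i]
      ring
  have hsurj : ∀ y : S, ∃ P : MvPolynomial J E, MvPolynomial.aeval s P = y := by
    intro y
    have : y ∈ Algebra.adjoin E (Set.range s) := by rw [hS.generates]; trivial
    rw [Algebra.adjoin_range_eq_range_aeval] at this
    exact this
  have hai : Function.Injective (MvPolynomial.aeval (R := E) s) := hS.algebraicIndependent
  obtain ⟨P, rfl⟩ := hsurj h
  have h1 : Φ P - P = MvPolynomial.C f := by
    apply hai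
    rw [map_sub, hΦS, hf, MvPolynomial.aeval_C]
  have h2 : ∀ j, Φ (MvPolynomial.pderiv j P) = MvPolynomial.pderiv j P := by
    intro j
    have := congrArg (MvPolynomial.pderiv j) h1
    rw [map_sub, MvPolynomial.pderiv_C, hΦ, MvPolynomial.pderiv_shift] at this
    exact sub_eq_zero.mp this
  -- `Φ P - P` has no variables, so the derivatives of `P` are `Φ`-invariant; since `S` has no new
  -- constants, they come from `E`.
  have h3 : ∀ j, ∃ c : E, MvPolynomial.pderiv j P = MvPolynomial.C c := by
    intro j
    obtain ⟨c, hc⟩ := hS.const (MvPolynomial.aeval s (MvPolynomial.pderiv j P))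
      (by rw [← hΦS, h2])
    refine ⟨c, hai ?_⟩
    rw [hc, MvPolynomial.aeval_C]
  choose c hc using h3
  have hconst : ∀ j, σE (c j) = c j := by
    intro j
    have h4 := h2 j
    rw [hc j, hΦ, MvPolynomial.coe_eval₂Hom, MvPolynomial.eval₂_C] at h4
    exact MvPolynomial.C_injective _ _ h4
  -- Removing the linear part with coefficients `c j` kills every partial derivative.
  have h5 := MvPolynomial.eq_C_of_pderiv_eq_zero
    (P := P - ∑ j, MvPolynomial.C (c j) * MvPolynomial.X j) (by
      intro j
      rw [map_sub, map_sum, hc j]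
      simp only [MvPolynomial.pderiv_C_mul, MvPolynomial.pderiv_X]
      rw [Finset.sum_eq_single j]
      · simp
      · intro i _ hi; simp [hi]
      · simp)
  refine ⟨c, (P - ∑ j, MvPolynomial.C (c j) * MvPolynomial.X j).coeff 0, hconst, ?_⟩
  conv_lhs => rw [← sub_add_cancel P (∑ j, MvPolynomial.C (c j) * MvPolynomial.X j), h5]
  simp [map_sum, add_comm]

end SigmaExtension

/-! ### Coefficient rings: expansions over subrings, and how `σ` moves them -/

section Stage

variable {A : Type*} [CommRing A] {E : Type*} [CommRing E] [Algebra A E] {e : ℕ}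
  {σA : RingAut A} {σE : RingAut E} {kind : Fin e → MonomialKind} {t : Fin e → E}

theorem IsRPiSigmaExt.powCoeffs_eq (h : IsRPiSigmaExt σA σE kind t) {f : E}
    {c : (Fin e → ℤ) →₀ A} (hc : IsExpansion kind t f c) : powCoeffs A kind t f = c :=
  (h.existsUnique_expansion f).unique (h.isExpansion_powCoeffs f) hc

theorem IsRPiSigmaExt.powCoeffs_add (h : IsRPiSigmaExt σA σE kind t) (f g : E) :
    powCoeffs A kind t (f + g) = powCoeffs A kind t f + powCoeffs A kind t g := by
  classical
  apply h.powCoeffs_eq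
  have hf := h.isExpansion_powCoeffs f
  have hg := h.isExpansion_powCoeffs g
  refine ⟨fun n hn => ?_, ?_⟩
  · rcases Finset.mem_union.mp (Finsupp.support_add hn) with hn | hn
    exacts [hf.1 n hn, hg.1 n hn]
  · rw [Finsupp.sum_add_index' (by simp) (by intros; rw [add_smul]), hf.2, hg.2]

theorem IsRPiSigmaExt.powCoeffs_smul (h : IsRPiSigmaExt σA σE kind t) (a : A) (f : E) :
    powCoeffs A kind t (a • f) = a • powCoeffs A kind t f := by
  apply h.powCoeffs_eq
  have hf := h.isExpansion_powCoeffs f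
  refine ⟨fun n hn => hf.1 n (Finsupp.support_smul hn), ?_⟩
  rw [Finsupp.sum_smul_index (by simp)]
  conv_rhs => rw [← hf.2, Finsupp.smul_sum]
  simp only [mul_smul]

theorem IsRPiSigmaExt.powCoeffs_eq_zero_iff (h : IsRPiSigmaExt σA σE kind t) {f : E} :
    powCoeffs A kind t f = 0 ↔ f = 0 := by
  constructor
  · intro h0
    have := (h.isExpansion_powCoeffs f).2
    rw [h0, Finsupp.sum_zero_index] at this
    exact this.symm
  · rintro rfl
    exact h.powCoeffs_eq ⟨by simp, by simp⟩

/-- Over any ring of coefficients, the reduced power products of the first `k` generators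
span `R⟨t₁⟩⋯⟨tₖ⟩`. -/
theorem IsRPiSigmaExt.mem_span_of_mem_stage (h : IsRPiSigmaExt σA σE kind t)
    {R : Type*} [CommRing R] [Algebra R E] {k : ℕ} {x : E} (hx : x ∈ stage R kind t k) :
    x ∈ Submodule.span R (powProd t ''
      {n : Fin e → ℤ | (∀ i, (kind i).Reduced (n i)) ∧ ∀ i : Fin e, k ≤ i → n i = 0}) := by
  set N := Submodule.span R (powProd t ''
      {n : Fin e → ℤ | (∀ i, (kind i).Reduced (n i)) ∧ ∀ i : Fin e, k ≤ i → n i = 0}) with hN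
  have key : ∀ (i : Fin e) (z : E), (i : ℕ) < k →
      (∀ m, (kind i).Reduced m → ∃ m', (kind i).Reduced m' ∧
      intPow (t i) m * z = intPow (t i) m') → ∀ y ∈ N, y * z ∈ N := by
    intro i z hik hz y hy
    induction hy using Submodule.span_induction with
    | mem y hy =>
      obtain ⟨n, ⟨hn, hn0⟩, rfl⟩ := hy
      obtain ⟨m', hm', he⟩ := hz (n i) (hn i)
      apply Submodule.subset_span
      refine ⟨Function.update n i m', ⟨fun j => ?_, fun j hj => ?_⟩, ?_⟩
      · by_cases hj : j = i
        · subst hj; simpa using hm'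
        · simpa [hj] using hn j
      · have : j ≠ i := by rintro rfl; omega
        simpa [this] using hn0 j hj
      · rw [powProd_update, ← he]
        conv_rhs => rw [← Function.update_eq_self i n, powProd_update]
        ring
    | zero => simp
    | add a b _ _ ha hb => rw [add_mul]; exact N.add_mem ha hb
    | smul a y _ ha => rw [smul_mul_assoc]; exact N.smul_mem _ ha
  -- The elements that multiply `N` into itself form a subalgebra, so generators suffice.
  have hmul : ∀ y ∈ N, y * x ∈ N := by
    refine Algebra.adjoin_induction (p := fun x _ => ∀ y ∈ N, y * x ∈ N) ?_ ?_ ?_ ?_ hx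
    · rintro x ⟨j, hjk, rfl | ⟨hj, rfl⟩⟩
      · exact key j _ hjk fun m hm => h.exists_mul_self j hm
      · refine key j _ hjk fun m _ => ⟨m - 1, ?_, intPow_mul_inverse (h.pi j hj).1 m⟩
        rw [hj]; trivial
    · intro a y hy
      rw [mul_comm, ← Algebra.smul_def]; exact N.smul_mem _ hy
    · intro a b _ _ ha hb y hy
      rw [mul_add]; exact N.add_mem (ha y hy) (hb y hy)
    · intro a b _ _ ha hb y hy
      rw [← mul_assoc]; exact hb _ (ha y hy)
  have h1 : (1 : E) ∈ N := by
    apply Submodule.subset_span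
    refine ⟨0, ⟨fun i => ?_, fun _ _ => rfl⟩, by simp [powProd, intPow_zero]⟩
    cases hi : kind i with
    | pi => trivial
    | sigma => exact le_refl (0 : ℤ)
    | root ν =>
      have := (h.root i ν hi).1
      exact ⟨le_rfl, by simp; omega⟩
  simpa using hmul 1 h1

/-- The coefficients of an element of `R⟨t₁⟩⋯⟨tₖ⟩` come from `R`, and they vanish at all exponent
vectors involving later generators. -/
theorem IsRPiSigmaExt.powCoeffs_of_mem_stage (h : IsRPiSigmaExt σA σE kind t)
    {R : Type*} [CommRing R] [Algebra R A] [Algebra R E] [IsScalarTower R A E] {k : ℕ} {f : E}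
    (hf : f ∈ stage R kind t k) (n : Fin e → ℤ) :
    powCoeffs A kind t f n ∈ (algebraMap R A).range ∧
      (powCoeffs A kind t f n ≠ 0 → ∀ i : Fin e, k ≤ i → n i = 0) := by
  obtain ⟨l, hl, hlf⟩ :=
    (Finsupp.mem_span_image_iff_linearCombination R).mp (h.mem_span_of_mem_stage hf)
  rw [Finsupp.mem_supported] at hl
  -- An expansion over `R` is also one over `A`, and expansions over `A` are unique.
  have hc : powCoeffs A kind t f = l.mapRange (algebraMap R A) (map_zero _) := by
    apply h.powCoeffs_eq
    refine ⟨fun n hn => (hl (Finsupp.support_mapRange hn)).1, ?_⟩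
    rw [Finsupp.sum_mapRange_index (by simp), ← hlf, Finsupp.linearCombination_apply]
    simp only [algebraMap_smul]
  rw [hc]
  refine ⟨⟨l n, by simp⟩, fun hn => ?_⟩
  have hn' : n ∈ l.support := by
    rw [Finsupp.mem_support_iff]
    intro h0
    simp [h0] at hn
  exact (hl hn').2

theorem IsRPiSigmaExt.mem_stage_of_powCoeffs (h : IsRPiSigmaExt σA σE kind t) (B : Subring A)
    {k : ℕ} {f : E} (hB : ∀ n, powCoeffs A kind t f n ∈ B)
    (h0 : ∀ n, powCoeffs A kind t f n ≠ 0 → ∀ i : Fin e, k ≤ i → n i = 0) :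
    f ∈ stage B kind t k := by
  obtain ⟨hred, hsum⟩ := h.isExpansion_powCoeffs f
  rw [← hsum]
  refine Subalgebra.sum_mem _ fun n hn => ?_
  exact Subalgebra.smul_mem _ (powProd_mem_stage (hred n hn)
    (h0 n (Finsupp.mem_support_iff.mp hn))) (⟨_, hB n⟩ : B)

theorem IsRPiSigmaExt.mem_stage_top_iff (h : IsRPiSigmaExt σA σE kind t) (B : Subring A)
    {f : E} : f ∈ stage B kind t e ↔ ∀ n, powCoeffs A kind t f n ∈ B := by
  constructor
  · intro hf n
    obtain ⟨y, hy⟩ := (h.powCoeffs_of_mem_stage hf n).1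
    rw [← hy]; exact y.2
  · intro hB
    exact h.mem_stage_of_powCoeffs B hB fun n _ i hi => absurd i.2 (by omega)

/-- Regular coefficients alone would place `f` only in the full ring over `B`. Keeping the level `k`
is what allows induction along the tower in `IsRPiSigmaExt.map_mem_stage_iff`. -/
theorem IsRPiSigmaExt.mem_stage_subring (h : IsRPiSigmaExt σA σE kind t) (B : Subring A)
    {k : ℕ} {f : E} (hf : f ∈ stage A kind t k) (hB : ∀ n, powCoeffs A kind t f n ∈ B) :
    f ∈ stage B kind t k :=
  h.mem_stage_of_powCoeffs B hB fun n => (h.powCoeffs_of_mem_stage hf n).2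

theorem IsRPiSigmaExt.isUnit_of_ne_sigma (h : IsRPiSigmaExt σA σE kind t) {i : Fin e}
    (hi : kind i ≠ MonomialKind.sigma) : IsUnit (t i) := by
  cases hk : kind i with
  | pi => exact (h.pi i hk).1
  | sigma => exact absurd hk hi
  | root ν =>
    obtain ⟨hν, hr, -⟩ := h.root i ν hk
    exact IsUnit.of_pow_eq_one hr (by omega)

theorem stage_mono {R : Type*} [CommRing R] [Algebra R E] {k k' : ℕ} (hk : k ≤ k') :
    stage R kind t k ≤ stage R kind t k' :=
  Algebra.adjoin_mono fun _ ⟨j, hj, hy⟩ => ⟨j, hj.trans_le hk, hy⟩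

theorem mem_stage_of_lt {R : Type*} [CommRing R] [Algebra R E] {k : ℕ} {i : Fin e}
    (hik : (i : ℕ) < k) : t i ∈ stage R kind t k :=
  Algebra.subset_adjoin ⟨i, hik, Or.inl rfl⟩

/-- Only inverses of Π-monomials are among the generators; for an R-monomial the inverse is the
power `ν - 1`. -/
theorem IsRPiSigmaExt.inverse_mem_stage (h : IsRPiSigmaExt σA σE kind t)
    {R : Type*} [CommRing R] [Algebra R E] {k : ℕ} {i : Fin e} (hik : (i : ℕ) < k)
    (hi : kind i ≠ MonomialKind.sigma) : Ring.inverse (t i) ∈ stage R kind t k := by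
  cases hk : kind i with
  | pi => exact Algebra.subset_adjoin ⟨i, hik, Or.inr ⟨hk, rfl⟩⟩
  | sigma => exact absurd hk hi
  | root ν =>
    obtain ⟨hν, hr, -⟩ := h.root i ν hk
    have hu := h.isUnit_of_ne_sigma hi
    have : Ring.inverse (t i) = t i ^ (ν - 1) := by
      apply hu.mul_left_cancel
      rw [Ring.mul_inverse_cancel _ hu, ← pow_succ', Nat.sub_add_cancel (by omega), hr]
    rw [this]
    exact pow_mem (mem_stage_of_lt hik) _

/-- Meant for the exponents in a simple quotient, which need not be reduced: an R-monomial may occur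
with any integer exponent. -/
theorem IsRPiSigmaExt.powProd_mem_stage_of_unit (h : IsRPiSigmaExt σA σE kind t)
    {R : Type*} [CommRing R] [Algebra R E] {k : ℕ} {n : Fin e → ℤ}
    (h0 : ∀ i : Fin e, k ≤ i → n i = 0) (hn : ∀ i, kind i = MonomialKind.sigma → n i = 0) :
    powProd t n ∈ stage R kind t k := by
  refine Subalgebra.prod_mem _ fun i _ => ?_
  by_cases hi : k ≤ i ∨ kind i = MonomialKind.sigma
  · rw [hi.elim (h0 i) (hn i), intPow_zero]; exact one_mem _
  · push Not at hi
    exact mul_mem (pow_mem (mem_stage_of_lt hi.1) _)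
      (pow_mem (h.inverse_mem_stage hi.1 hi.2) _)

theorem IsRPiSigmaExt.powProd_mul_powProd_neg (h : IsRPiSigmaExt σA σE kind t)
    {n : Fin e → ℤ} (hn : ∀ i, kind i = MonomialKind.sigma → n i = 0) :
    powProd t n * powProd t (-n) = 1 := by
  unfold powProd
  rw [← Finset.prod_mul_distrib]
  refine Finset.prod_eq_one fun i _ => ?_
  by_cases hi : kind i = MonomialKind.sigma
  · simp [hn i hi, intPow_zero]
  · have hu := Ring.mul_inverse_cancel _ (h.isUnit_of_ne_sigma hi)
    unfold intPow
    rw [Pi.neg_apply, neg_neg]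
    calc _ = (t i * Ring.inverse (t i)) ^ (n i).toNat *
          (t i * Ring.inverse (t i)) ^ (-n i).toNat := by rw [mul_pow, mul_pow]; ring
      _ = 1 := by rw [hu, one_pow, one_pow, one_mul]

/-- If `σ` maps the coefficient ring `B` onto `B'` and `σ(tᵢ)/tᵢ`, `tᵢ/σ(tᵢ)` or `σ(tᵢ) - tᵢ`
have coefficients in `B'`, then `σ` maps `B⟨t₁⟩⋯⟨tₑ⟩` onto `B'⟨t₁⟩⋯⟨tₑ⟩`. -/
theorem IsRPiSigmaExt.map_mem_stage_iff (h : IsRPiSigmaExt σA σE kind t) {B B' : Subring A}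
    (hB : ∀ a, σA a ∈ B' ↔ a ∈ B)
    (hu : ∀ i, kind i ≠ MonomialKind.sigma → ∃ w ∈ stage B' kind t i, ∃ w' ∈ stage B' kind t i,
      w * w' = 1 ∧ σE (t i) = w * t i)
    (hs : ∀ i, kind i = MonomialKind.sigma → σE (t i) - t i ∈ stage B' kind t i) (f : E) :
    σE f ∈ stage B' kind t e ↔ f ∈ stage B kind t e := by
  have hinv : ∀ i w w', kind i ≠ MonomialKind.sigma → w * w' = 1 → σE (t i) = w * t i →
      σE (Ring.inverse (t i)) = w' * Ring.inverse (t i) := by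
    intro i w w' hi hw hσ
    have hc := Ring.mul_inverse_cancel _ (h.isUnit_of_ne_sigma hi)
    have h1 : σE (t i) * σE (Ring.inverse (t i)) = 1 := by rw [← map_mul, hc, map_one]
    rw [hσ] at h1
    linear_combination (w' * Ring.inverse (t i)) * h1 - σE (Ring.inverse (t i)) * (t i *
      Ring.inverse (t i)) * hw - σE (Ring.inverse (t i)) * hc
  have hmapB : ∀ b : B, σE (algebraMap B E b) ∈ stage B' kind t e := by
    intro b
    have h1 : σE (algebraMap B E b) = algebraMap A E (σA b) := h.map_algebraMap b
    rw [h1]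
    exact Subalgebra.algebraMap_mem (stage B' kind t e) (⟨σA b, (hB b).mpr b.2⟩ : B')
  have hle : ∀ i : Fin e, stage B' kind t i ≤ stage B' kind t e := fun i => stage_mono i.2.le
  have hgen : ∀ i : Fin e, t i ∈ stage B' kind t e :=
    fun i => mem_stage_of_lt i.2
  have hgenB : ∀ i : Fin e, t i ∈ stage B kind t e :=
    fun i => mem_stage_of_lt i.2
  constructor
  -- The multiplier or increment of `t i` lives in the strictly smaller stage `i`, where the
  -- induction hypothesis applies. For a Σ-monomial `σ⁻¹(t) = t - σ⁻¹(σ(t) - t)`; otherwise `σ⁻¹(t)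
  -- = σ⁻¹(w') t`.
  · have key : ∀ k, k ≤ e → ∀ x ∈ stage B' kind t k, σE.symm x ∈ stage B kind t e := by
      intro k
      induction k using Nat.strong_induction_on with
      | _ k ih =>
        intro hk x hx
        refine Algebra.adjoin_induction (p := fun x _ => σE.symm x ∈ stage B kind t e)
          ?_ ?_ ?_ ?_ hx
        · rintro x ⟨i, hik, hxi⟩
          by_cases hi : kind i = MonomialKind.sigma
          · have hx1 : x = t i := hxi.elim id fun hh => by rw [hh.1] at hi; cases hi
            have h1 := ih i hik i.2.le _ (hs i hi)
            rw [map_sub, RingEquiv.symm_apply_apply] at h1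
            have h2 := sub_mem (hgenB i) h1
            rwa [sub_sub_cancel, ← hx1] at h2
          · obtain ⟨w, hw, w', hw', hww, hσ⟩ := hu i hi
            have h1 := ih i hik i.2.le _ hw
            have h2 := ih i hik i.2.le _ hw'
            rcases hxi with rfl | ⟨-, rfl⟩
            · have h3 : t i = w' * σE (t i) := by
                rw [hσ]; linear_combination -t i * hww
              rw [h3, map_mul, RingEquiv.symm_apply_apply]
              exact mul_mem h2 (hgenB i)
            · have h3 : Ring.inverse (t i) = w * σE (Ring.inverse (t i)) := by
                rw [hinv i w w' hi hww hσ]; linear_combination -Ring.inverse (t i) * hww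
              rw [h3, map_mul, RingEquiv.symm_apply_apply]
              exact mul_mem h1 (h.inverse_mem_stage i.2 hi)
        · intro b
          have h1 : σE.symm (algebraMap B' E b) = algebraMap A E (σA.symm b) := by
            rw [RingEquiv.symm_apply_eq, h.map_algebraMap, RingEquiv.apply_symm_apply]; rfl
          rw [h1]
          exact Subalgebra.algebraMap_mem (stage B kind t e)
            (⟨σA.symm b, (hB _).mp (by rw [RingEquiv.apply_symm_apply]; exact b.2)⟩ : B)
        · intro x y _ _ hx hy; rw [map_add]; exact add_mem hx hy
        · intro x y _ _ hx hy; rw [map_mul]; exact mul_mem hx hy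
    intro hf
    simpa using key e le_rfl _ hf
  · intro hf
    refine Algebra.adjoin_induction (p := fun x _ => σE x ∈ stage B' kind t e)
      ?_ hmapB ?_ ?_ hf
    · rintro x ⟨i, hik, hxi⟩
      by_cases hi : kind i = MonomialKind.sigma
      · have hx1 : x = t i := hxi.elim id fun hh => by rw [hh.1] at hi; cases hi
        rw [hx1, ← sub_add_cancel (σE (t i)) (t i)]
        exact add_mem (hle i (hs i hi)) (hgen i)
      · obtain ⟨w, hw, w', hw', hww, hσ⟩ := hu i hi
        rcases hxi with rfl | ⟨-, rfl⟩
        · rw [hσ]; exact mul_mem (hle i hw) (hgen i)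
        · rw [hinv i w w' hi hww hσ]
          exact mul_mem (hle i hw') (h.inverse_mem_stage i.2 hi)
    · intro x y _ _ hx hy; rw [map_add]; exact add_mem hx hy
    · intro x y _ _ hx hy; rw [map_mul]; exact mul_mem hx hy

end Stage

/-! ### Orbits of primes of `F[x]` under `σ`, and their local rings -/

section Field

variable {F : Type*} [Field F] {σ₀ : RingAut F} {σ : RingAut (RatFunc F)} {τ : RingAut F[X]}

/-- The automorphism of a ΠΣ-field extension `F(x)` restricts to a degree preserving automorphism
of `F[x]`. -/
theorem IsPiSigmaFieldExt.exists_polyAut (hσ : IsPiSigmaFieldExt σ₀ σ) :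
    ∃ τ : RingAut F[X], (∀ f, σ (algebraMap F[X] (RatFunc F) f) = algebraMap _ _ (τ f)) ∧
      ∀ f, (τ f).natDegree = f.natDegree := by
  -- Both kinds of generator are affine substitutions `x ↦ a x + b` with `a ≠ 0`, which treats them
  -- uniformly.
  obtain ⟨a, b, ha, hX⟩ : ∃ a b : F, a ≠ 0 ∧
      σ RatFunc.X = RatFunc.C a * RatFunc.X + RatFunc.C b := by
    rcases hσ.monomial with ⟨a, ha, h⟩ | ⟨b, h⟩
    · exact ⟨a, 0, ha, by simp [h]⟩
    · exact ⟨1, b, one_ne_zero, by simp [h]⟩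
  let _ := invertibleOfNonzero ha
  refine ⟨(mapEquiv σ₀).trans (algEquivCMulXAddC a b).toRingEquiv, fun f => ?_, fun f => ?_⟩
  · have : (σ : RatFunc F →+* RatFunc F).comp (algebraMap F[X] (RatFunc F)) =
        (algebraMap F[X] (RatFunc F)).comp
          ((mapEquiv σ₀).trans (algEquivCMulXAddC a b).toRingEquiv : F[X] →+* F[X]) := by
      refine Polynomial.ringHom_ext (fun c => ?_) ?_
      · simp [hσ.map_C]
      · simp [hX]
    exact congrArg (fun φ : F[X] →+* RatFunc F => φ f) this
  · have : ((mapEquiv σ₀).trans (algEquivCMulXAddC a b).toRingEquiv) f =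
        (f.map (σ₀ : F →+* F)).comp (C a * X + C b) := by
      simp [aeval_def, comp, algebraMap_eq]
    rw [this, natDegree_comp, natDegree_linear ha, mul_one, natDegree_map]

theorem zpow_algebraMap (hτ : ∀ f, σ (algebraMap F[X] (RatFunc F) f) = algebraMap _ _ (τ f))
    (k : ℤ) (f : F[X]) :
    (σ ^ k) (algebraMap F[X] (RatFunc F) f) = algebraMap _ _ ((τ ^ k) f) := by
  induction k using Int.induction_on generalizing f with
  | zero => rfl
  | succ n ih => rw [zpow_add_one, zpow_add_one, RingAut.mul_apply, hτ, ih]; rfl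
  | pred n ih =>
    have h1 : σ⁻¹ (algebraMap F[X] (RatFunc F) f) = algebraMap _ _ (τ⁻¹ f) := by
      apply σ.injective
      rw [hτ]
      exact (σ.apply_symm_apply _).trans (congrArg _ (τ.apply_symm_apply f).symm)
    rw [zpow_sub_one, zpow_sub_one, RingAut.mul_apply, h1, ih]; rfl

theorem zpow_apply_zpow_apply (j k : ℤ) (f : F[X]) : (τ ^ j) ((τ ^ k) f) = (τ ^ (j + k)) f := by
  rw [zpow_add]; rfl

theorem natDegree_zpow (hdeg : ∀ f, (τ f).natDegree = f.natDegree) (k : ℤ) (f : F[X]) :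
    ((τ ^ k) f).natDegree = f.natDegree := by
  induction k using Int.induction_on with
  | zero => rfl
  | succ n ih => rw [add_comm, ← zpow_apply_zpow_apply, zpow_one, hdeg, ih]
  | pred n ih =>
    have h : τ ((τ ^ (-(n : ℤ) - 1)) f) = (τ ^ (-(n : ℤ))) f := by
      have := zpow_apply_zpow_apply (τ := τ) 1 (-(n : ℤ) - 1) f
      rwa [zpow_one, add_sub_cancel] at this
    rw [← ih, ← h, hdeg]

/-- Units of `F[x]` are the nonzero constants, so a quotient in `F` means association. This turns
period and `σ`-equivalence into statements about primes up to associates. -/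
theorem exists_zpow_div_eq_C_iff
    (hτ : ∀ f, σ (algebraMap F[X] (RatFunc F) f) = algebraMap _ _ (τ f)) (k : ℤ) {p v : F[X]}
    (hp : p ≠ 0) (hv : v ≠ 0) :
    (∃ c : F, (σ ^ k) (algebraMap F[X] (RatFunc F) p) / algebraMap F[X] (RatFunc F) v =
      RatFunc.C c) ↔ Associated ((τ ^ k) p) v := by
  have hv' : algebraMap F[X] (RatFunc F) v ≠ 0 := RatFunc.algebraMap_ne_zero hv
  have key : ∀ c : F, (σ ^ k) (algebraMap F[X] (RatFunc F) p) / algebraMap F[X] (RatFunc F) v =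
      RatFunc.C c ↔ (τ ^ k) p = C c * v := by
    intro c
    rw [zpow_algebraMap hτ, div_eq_iff hv', ← RatFunc.algebraMap_C, ← map_mul]
    exact (RatFunc.algebraMap_injective F).eq_iff
  simp only [key]
  constructor
  · rintro ⟨c, hc⟩
    have hc0 : c ≠ 0 := by
      rintro rfl
      rw [C_0, zero_mul] at hc
      exact hp ((τ ^ k).injective (hc.trans (map_zero _).symm))
    rw [hc]
    exact (associated_isUnit_mul_left_iff (isUnit_C.mpr hc0.isUnit)).mpr (Associated.refl v)
  · intro h
    obtain ⟨u, hu⟩ := h.symm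
    obtain ⟨c, -, hc⟩ := Polynomial.isUnit_iff.mp u.isUnit
    exact ⟨c, by rw [← hu, ← hc, mul_comm]⟩

/-- The period looks only at positive powers; a negative `k` is handled by applying `τ ^ (-k)` to
the association. -/
theorem period_eq_zero_iff
    (hτ : ∀ f, σ (algebraMap F[X] (RatFunc F) f) = algebraMap _ _ (τ f)) {p : F[X]}
    (hp : p ≠ 0) :
    period σ (algebraMap F[X] (RatFunc F) p) = 0 ↔
      ∀ k : ℤ, Associated ((τ ^ k) p) p → k = 0 := by
  have h1 : period σ (algebraMap F[X] (RatFunc F) p) = 0 ↔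
      ∀ n : ℕ, 0 < n → ¬ Associated ((τ ^ (n : ℤ)) p) p := by
    unfold period
    rw [Nat.sInf_eq_zero]
    simp only [← zpow_natCast, exists_zpow_div_eq_C_iff hτ _ hp hp]
    constructor
    · rintro (h | h) n hn ha
      · exact absurd h.1 (by omega)
      · have : n ∈ (∅ : Set ℕ) := h ▸ ⟨hn, ha⟩
        exact this
    · intro h
      right
      ext n
      simp only [Set.mem_ofPred_eq, Set.mem_empty_iff_false, iff_false, not_and]
      exact h n
  rw [h1]
  constructor
  · intro h k hk
    by_contra hk0
    rcases lt_or_gt_of_ne hk0 with hlt | hgt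
    · refine h (-k).toNat (by omega) ?_
      have := (hk.map ((τ ^ (-k) : RingAut F[X]) : F[X] →* F[X])).symm
      simp only [MonoidHom.coe_coe, zpow_apply_zpow_apply, neg_add_cancel, zpow_zero] at this
      rw [Int.toNat_of_nonneg (by omega)]
      exact this
    · refine h k.toNat (by omega) ?_
      rwa [Int.toNat_of_nonneg (by omega)]
  · intro h n hn ha
    have := h n ha
    omega

/-- The irreducible polynomials of period `0` and degree `> d`. -/
structure IsAperiodicPrime (σ : RingAut (RatFunc F)) (d : ℕ) (p : F[X]) : Prop where
  irreducible : Irreducible p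
  lt_natDegree : d < p.natDegree
  period_eq_zero : period σ (algebraMap F[X] (RatFunc F) p) = 0

theorem polyXDegLE_iff {d : ℕ} {f : F[X]} :
    PolyXDegLE σ d f ↔ ∀ p, IsAperiodicPrime σ d p → ¬ p ∣ f :=
  ⟨fun h p hp hf => absurd (h p hp.irreducible hf hp.period_eq_zero) (not_le.mpr hp.lt_natDegree),
    fun h p hp hf h0 => not_lt.mp fun hd => h p ⟨hp, hd, h0⟩ hf⟩

theorem IsAperiodicPrime.associated_zpow {d : ℕ} {p : F[X]} (hp : IsAperiodicPrime σ d p)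
    (hτ : ∀ f, σ (algebraMap F[X] (RatFunc F) f) = algebraMap _ _ (τ f)) {j k : ℤ}
    (h : Associated ((τ ^ j) p) ((τ ^ k) p)) : j = k := by
  have := h.map ((τ ^ (-k) : RingAut F[X]) : F[X] →* F[X])
  simp only [MonoidHom.coe_coe, zpow_apply_zpow_apply, neg_add_cancel, zpow_zero] at this
  have := (period_eq_zero_iff hτ hp.irreducible.ne_zero).mp hp.period_eq_zero _ this
  omega

theorem IsAperiodicPrime.zpow {d : ℕ} {p : F[X]} (hp : IsAperiodicPrime σ d p)
    (hτ : ∀ f, σ (algebraMap F[X] (RatFunc F) f) = algebraMap _ _ (τ f))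
    (hdeg : ∀ f, (τ f).natDegree = f.natDegree) (k : ℤ) :
    IsAperiodicPrime σ d ((τ ^ k) p) := by
  have hirr : Irreducible ((τ ^ k) p) := (MulEquiv.irreducible_iff (τ ^ k)).mpr hp.irreducible
  refine ⟨hirr, by rw [natDegree_zpow hdeg]; exact hp.lt_natDegree, ?_⟩
  rw [period_eq_zero_iff hτ hirr.ne_zero]
  intro j hj
  rw [zpow_apply_zpow_apply] at hj
  have := hp.associated_zpow hτ hj
  omega

/-- Regularity at `p` may be tested on any fraction, reduced or not; in this form it is easy to
transport along `σ`. -/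
theorem not_dvd_denom_iff {p : F[X]} (f : RatFunc F) :
    ¬ p ∣ f.denom ↔ ∃ a b : F[X], ¬ p ∣ b ∧
      f * algebraMap F[X] (RatFunc F) b = algebraMap F[X] (RatFunc F) a := by
  constructor
  · intro h
    exact ⟨f.num, f.denom, h, ((div_eq_iff (RatFunc.algebraMap_ne_zero f.denom_ne_zero)).mp
      f.num_div_denom).symm⟩
  · rintro ⟨a, b, hb, h⟩ hp
    have hb0 : b ≠ 0 := by rintro rfl; exact hb (dvd_zero p)
    refine hb (hp.trans ((RatFunc.denom_dvd hb0).mpr ⟨a, ?_⟩))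
    rw [eq_div_iff (RatFunc.algebraMap_ne_zero hb0), h]

/-- The local ring of `F[x]` at the prime `p`, as a subring of `F(x)`. -/
noncomputable def localSubring (p : F[X]) (hp : Prime p) : Subring (RatFunc F) where
  carrier := {f | ¬ p ∣ f.denom}
  one_mem' := by
    change ¬ p ∣ (1 : RatFunc F).denom
    rw [RatFunc.denom_one]; exact hp.not_dvd_one
  zero_mem' := by
    change ¬ p ∣ (0 : RatFunc F).denom
    rw [RatFunc.denom_zero]; exact hp.not_dvd_one
  mul_mem' {f g} hf hg h := (hp.dvd_or_dvd (h.trans (RatFunc.denom_mul_dvd f g))).elim hf hg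
  add_mem' {f g} hf hg h := (hp.dvd_or_dvd (h.trans (RatFunc.denom_add_dvd f g))).elim hf hg
  neg_mem' {f} hf := by
    obtain ⟨a, b, hb, h⟩ := (not_dvd_denom_iff f).mp hf
    exact (not_dvd_denom_iff (-f)).mpr ⟨-a, b, hb, by rw [neg_mul, h, map_neg]⟩

theorem mem_localSubring {p : F[X]} {hp : Prime p} {f : RatFunc F} :
    f ∈ localSubring p hp ↔ ¬ p ∣ f.denom := Iff.rfl

theorem map_mem_localSubring_iff
    (hτ : ∀ f, σ (algebraMap F[X] (RatFunc F) f) = algebraMap _ _ (τ f)) {p : F[X]}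
    (hp : Prime p) (hp' : Prime (τ p)) (f : RatFunc F) :
    σ f ∈ localSubring (τ p) hp' ↔ f ∈ localSubring p hp := by
  rw [mem_localSubring, mem_localSubring, not_dvd_denom_iff, not_dvd_denom_iff]
  constructor
  · rintro ⟨a, b, hb, h⟩
    obtain ⟨a, rfl⟩ := τ.surjective a
    obtain ⟨b, rfl⟩ := τ.surjective b
    refine ⟨a, b, fun h' => hb ((map_dvd_iff τ).mpr h'), σ.injective ?_⟩
    rw [map_mul, hτ, hτ, h]
  · rintro ⟨a, b, hb, h⟩
    exact ⟨τ a, τ b, fun h' => hb ((map_dvd_iff τ).mp h'), by rw [← hτ, ← hτ, ← h, map_mul]⟩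

/-- Neither numerator nor denominator is divisible by `p`, so `u` is a unit of the local ring. -/
theorem RatXDegLE.mem_localSubring {d : ℕ} {u : RatFunc F} (hu : RatXDegLE σ d u) {p : F[X]}
    (hp : IsAperiodicPrime σ d p) :
    u ∈ localSubring p hp.irreducible.prime ∧ u⁻¹ ∈ localSubring p hp.irreducible.prime := by
  have h1 := polyXDegLE_iff.mp hu.1 p hp
  have h2 := polyXDegLE_iff.mp hu.2 p hp
  refine ⟨h2, (not_dvd_denom_iff _).mpr ⟨u.denom, u.num, h1, ?_⟩⟩
  have h0 : u ≠ 0 := by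
    rintro rfl
    exact h1 (RatFunc.num_zero (K := F) ▸ dvd_zero p)
  have h3 := (div_eq_iff (RatFunc.algebraMap_ne_zero u.denom_ne_zero)).mp u.num_div_denom
  rw [h3, inv_mul_cancel_left₀ h0]

/-- In lowest terms `num ^ k = denom ^ k`, so a prime dividing the denominator also divides the
numerator. It serves for R-monomials, on which `ExtXDegLE` imposes nothing. -/
theorem mem_localSubring_of_pow_eq_one {u : RatFunc F} {k : ℕ} (hk : 0 < k)
    (hu : u ^ k = 1) {p : F[X]} (hp : Prime p) : u ∈ localSubring p hp := by
  intro hd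
  have h1 : u.num ^ k = u.denom ^ k := by
    apply RatFunc.algebraMap_injective F
    have h0 := RatFunc.algebraMap_ne_zero u.denom_ne_zero
    rw [← RatFunc.num_div_denom u, div_pow, div_eq_one_iff_eq (pow_ne_zero _ h0)] at hu
    rw [map_pow, map_pow, hu]
  have h2 : p ∣ u.num := hp.dvd_of_dvd_pow (h1 ▸ dvd_pow hd hk.ne')
  exact hp.not_isUnit (u.isCoprime_num_denom.isUnit_of_dvd' h2 hd)

end Field

/-! ### Poles of elements of `E` along orbits -/

section Regular

variable {F : Type*} [Field F] {E : Type*} [CommRing E] [Algebra (RatFunc F) E] {e : ℕ}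
  {σ₀ : RingAut F} {σ : RingAut (RatFunc F)} {σE : RingAut E} {τ : RingAut F[X]} {d : ℕ}
  {kind : Fin e → MonomialKind} {t : Fin e → E}

/-- No coefficient of `f` has a pole at `p`. -/
def RegularAt (kind : Fin e → MonomialKind) (t : Fin e → E) (p : F[X]) (f : E) : Prop :=
  ∀ n, ¬ p ∣ (powCoeffs (RatFunc F) kind t f n).denom

/-- The least common multiple divides the product of the denominators, so a prime dividing it
divides one of them. -/
theorem dvd_den_iff {p : F[X]} (hp : Prime p) (f : E) :
    p ∣ den kind t f ↔ ¬ RegularAt kind t p f := by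
  constructor
  · intro h hf
    have h1 : den kind t f ∣ ∏ n ∈ (powCoeffs (RatFunc F) kind t f).support,
        (powCoeffs (RatFunc F) kind t f n).denom := by
      rw [den_dvd_iff]
      intro n
      by_cases hn : n ∈ (powCoeffs (RatFunc F) kind t f).support
      · exact Finset.dvd_prod_of_mem _ hn
      · rw [Finsupp.notMem_support_iff.mp hn, RatFunc.denom_zero]
        exact one_dvd _
    obtain ⟨n, -, hn⟩ := hp.exists_mem_finset_dvd (h.trans h1)
    exact hf n hn
  · intro h
    unfold RegularAt at h
    push Not at h
    obtain ⟨n, hn⟩ := h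
    exact hn.trans ((den_dvd_iff kind t f _).mp dvd_rfl n)

theorem IsRPiSigmaExt.mem_stage_localSubring_iff (hE : IsRPiSigmaExt σ σE kind t) {p : F[X]}
    (hp : Prime p) {f : E} :
    f ∈ stage (localSubring p hp) kind t e ↔ RegularAt kind t p f :=
  hE.mem_stage_top_iff (localSubring p hp)

theorem RegularAt.add (hE : IsRPiSigmaExt σ σE kind t) {p : F[X]} (hp : Prime p) {f g : E}
    (hf : RegularAt kind t p f) (hg : RegularAt kind t p g) : RegularAt kind t p (f + g) := by
  rw [← hE.mem_stage_localSubring_iff hp] at *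
  exact add_mem hf hg

theorem RegularAt.sub (hE : IsRPiSigmaExt σ σE kind t) {p : F[X]} (hp : Prime p) {f g : E}
    (hf : RegularAt kind t p f) (hg : RegularAt kind t p g) : RegularAt kind t p (f - g) := by
  rw [← hE.mem_stage_localSubring_iff hp] at *
  exact sub_mem hf hg

theorem RegularAt.sum (hE : IsRPiSigmaExt σ σE kind t) {p : F[X]} (hp : Prime p)
    {ι : Type*} {I : Finset ι} {f : ι → E} (hf : ∀ i ∈ I, RegularAt kind t p (f i)) :
    RegularAt kind t p (∑ i ∈ I, f i) := by
  simp only [← hE.mem_stage_localSubring_iff hp] at *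
  exact sum_mem hf

theorem IsPolyElem.regularAt_polyDiv (hE : IsRPiSigmaExt σ σE kind t) {a : E}
    (ha : IsPolyElem F kind t a) {b p : F[X]} (hb : ¬ p ∣ b) :
    RegularAt kind t p (polyDiv a b) := by
  intro n
  obtain ⟨r, hr⟩ := ha n
  have hb0 : b ≠ 0 := by rintro rfl; exact hb (dvd_zero p)
  rw [not_dvd_denom_iff]
  refine ⟨r, b, hb, ?_⟩
  rw [polyDiv, hE.powCoeffs_smul, Finsupp.smul_apply, smul_eq_mul, ← hr, mul_comm,
    mul_inv_cancel_left₀ (RatFunc.algebraMap_ne_zero hb0)]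

/-- In a simple extension of `x`-degree `≤ d`, `σ` transports poles at aperiodic primes of
degree `> d`. -/
theorem IsRPiSigmaExt.regularAt_map_iff (hE : IsRPiSigmaExt σ σE kind t)
    (hsimple : IsSimpleExt (RatFunc F) σE kind t) (hx : ExtXDegLE σ σE d kind t)
    (hτ : ∀ f, σ (algebraMap F[X] (RatFunc F) f) = algebraMap _ _ (τ f))
    {p : F[X]} (hp : IsAperiodicPrime σ d p) (hp' : IsAperiodicPrime σ d (τ p)) (f : E) :
    RegularAt kind t (τ p) (σE f) ↔ RegularAt kind t p f := by
  rw [← hE.mem_stage_localSubring_iff hp.irreducible.prime,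
    ← hE.mem_stage_localSubring_iff hp'.irreducible.prime]
  refine hE.map_mem_stage_iff (map_mem_localSubring_iff hτ _ _) (fun i hi => ?_)
    (fun i hi => ?_) f
  -- The monomial part is a unit over any coefficient ring, so only `u` and `u⁻¹` must be regular at
  -- `τ p`.
  · have key : ∀ (u : RatFunc F) (m : Fin e → ℤ), IsSimpleQuotient σE kind t i u m →
        u ∈ localSubring (τ p) hp'.irreducible.prime →
        u⁻¹ ∈ localSubring (τ p) hp'.irreducible.prime →
        ∃ w ∈ stage (localSubring (τ p) hp'.irreducible.prime) kind t i,
        ∃ w' ∈ stage (localSubring (τ p) hp'.irreducible.prime) kind t i,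
          w * w' = 1 ∧ σE (t i) = w * t i := by
      rintro u m ⟨hu, hm0, hms, hσt⟩ h1 h2
      refine ⟨algebraMap _ E u * powProd t m, mul_mem ?_ ?_,
        algebraMap _ E u⁻¹ * powProd t (-m), mul_mem ?_ ?_, ?_, hσt⟩
      · exact Subalgebra.algebraMap_mem (stage (localSubring (τ p) _) kind t i)
          (⟨u, h1⟩ : localSubring (τ p) _)
      · exact hE.powProd_mem_stage_of_unit (fun j hj => hm0 j hj) hms
      · exact Subalgebra.algebraMap_mem (stage (localSubring (τ p) _) kind t i)
          (⟨u⁻¹, h2⟩ : localSubring (τ p) _)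
      · exact hE.powProd_mem_stage_of_unit (fun j hj => by simp [hm0 j hj])
          (fun j hj => by simp [hms j hj])
      · have h3 : algebraMap (RatFunc F) E u * algebraMap (RatFunc F) E u⁻¹ = 1 := by
          rw [← map_mul, mul_inv_cancel₀ hu.ne_zero, map_one]
        linear_combination h3 * (powProd t m * powProd t (-m)) +
          hE.powProd_mul_powProd_neg hms
    cases hk : kind i with
    | pi =>
      obtain ⟨u, m, hum, hud⟩ := hx.pi i hk
      exact key u m hum (hud.mem_localSubring hp').1 (hud.mem_localSubring hp').2
    | sigma => exact absurd hk hi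
    | root ν =>
      obtain ⟨u, m, hum, ⟨k, hk0, huk⟩, -⟩ := hsimple.root i ν hk
      exact key u m hum (mem_localSubring_of_pow_eq_one hk0 huk _)
        (mem_localSubring_of_pow_eq_one hk0 (by rw [inv_pow, huk, inv_one]) _)
  · refine hE.mem_stage_subring _ (hE.sigma i hi) fun n => ?_
    have h1 := polyXDegLE_iff.mp (hx.sigma i hi) _ hp'
    rw [dvd_den_iff hp'.irreducible.prime, not_not] at h1
    exact h1 n

/-- Only finitely many members of the orbit of `p` are poles of `v`. -/
theorem IsAperiodicPrime.finite_not_regularAt {p : F[X]} (hp : IsAperiodicPrime σ d p)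
    (hτ : ∀ f, σ (algebraMap F[X] (RatFunc F) f) = algebraMap _ _ (τ f))
    (hdeg : ∀ f, (τ f).natDegree = f.natDegree) (v : E) :
    {k : ℤ | ¬ RegularAt kind t ((τ ^ k) p) v}.Finite := by
  classical
  -- Poles in the orbit give normalized prime factors of the denominator of `v`, distinct ones
  -- because `p` has period 0.
  refine Set.Finite.of_injOn (f := fun k : ℤ => normalize ((τ ^ k) p)) ?_ ?_
    (UniqueFactorizationMonoid.normalizedFactors (den kind t v)).toFinset.finite_toSet
  · intro k hk
    have hirr := (hp.zpow hτ hdeg k).irreducible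
    rw [Set.mem_ofPred_eq, ← dvd_den_iff hirr.prime] at hk
    simp only [Finset.mem_coe, Multiset.mem_toFinset]
    rw [UniqueFactorizationMonoid.mem_normalizedFactors_iff' (den_monic kind t v).ne_zero]
    exact ⟨(normalize_associated _).irreducible_iff.mpr hirr, normalize_idem _,
      normalize_dvd_iff.mpr hk⟩
  · intro j _ k _ hjk
    exact hp.associated_zpow hτ (normalize_eq_normalize_iff_associated.mp hjk)

/-- If `σ(v) - v` has at most one pole in the orbit of `p`, then `v` is regular along this
orbit. -/
theorem IsRPiSigmaExt.regularAt_of_orbit (hE : IsRPiSigmaExt σ σE kind t)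
    (hsimple : IsSimpleExt (RatFunc F) σE kind t) (hx : ExtXDegLE σ σE d kind t)
    (hτ : ∀ f, σ (algebraMap F[X] (RatFunc F) f) = algebraMap _ _ (τ f))
    (hdeg : ∀ f, (τ f).natDegree = f.natDegree)
    {p : F[X]} (hp : IsAperiodicPrime σ d p) {v : E}
    (hv : ∀ j k : ℤ, ¬ RegularAt kind t ((τ ^ j) p) (σE v - v) →
      ¬ RegularAt kind t ((τ ^ k) p) (σE v - v) → j = k) :
    RegularAt kind t p v := by
  by_contra hne
  have hmap : ∀ k : ℤ, RegularAt kind t ((τ ^ (k + 1)) p) (σE v) ↔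
      RegularAt kind t ((τ ^ k) p) v := by
    intro k
    have h1 : τ ((τ ^ k) p) = (τ ^ (k + 1)) p := by
      have := zpow_apply_zpow_apply (τ := τ) 1 k p
      rwa [zpow_one, add_comm] at this
    rw [← h1]
    exact hE.regularAt_map_iff hsimple hx hτ (hp.zpow hτ hdeg k)
      (h1 ▸ hp.zpow hτ hdeg (k + 1)) v
  have hfin := hp.finite_not_regularAt (kind := kind) (t := t) hτ hdeg v
  have hnonempty : hfin.toFinset.Nonempty :=
    ⟨0, by simpa using hne⟩
  have hmem : ∀ k, k ∈ hfin.toFinset ↔ ¬ RegularAt kind t ((τ ^ k) p) v := by simp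
  -- `M` and `m` are the last and first poles of `v` in the orbit. The poles of `σ(v)` are those of
  -- `v` moved by one, so `σ(v) - v` has poles at `M + 1` and at `m`, and `m < M + 1`.
  set M := hfin.toFinset.max' hnonempty
  set m := hfin.toFinset.min' hnonempty
  have hM := (hmem M).mp (Finset.max'_mem _ _)
  have hm := (hmem m).mp (Finset.min'_mem _ _)
  have hM1 : RegularAt kind t ((τ ^ (M + 1)) p) v := by
    by_contra h
    have := Finset.le_max' _ _ ((hmem _).mpr h)
    change M + 1 ≤ M at this
    omega
  have hm1 : RegularAt kind t ((τ ^ (m - 1)) p) v := by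
    by_contra h
    have := Finset.min'_le _ _ ((hmem _).mpr h)
    change m ≤ m - 1 at this
    omega
  have hmM : m ≤ M := Finset.min'_le _ _ (Finset.max'_mem _ _)
  have h1 : ¬ RegularAt kind t ((τ ^ (M + 1)) p) (σE v - v) := by
    intro h
    have := h.add hE (hp.zpow hτ hdeg _).irreducible.prime hM1
    rw [sub_add_cancel, hmap] at this
    exact hM this
  have h2 : ¬ RegularAt kind t ((τ ^ m) p) (σE v - v) := by
    intro h
    have h3 : RegularAt kind t ((τ ^ m) p) (σE v) := by
      rw [← hmap, sub_add_cancel] at hm1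
      exact hm1
    have := h3.sub hE (hp.zpow hτ hdeg _).irreducible.prime h
    rw [sub_sub_cancel] at this
    exact hm this
  have := hv _ _ h1 h2
  omega

/-- If `σ(v) - v` is in `σ`-reduced form, then all its `Q`-contributions vanish, and `v` is regular
at all aperiodic primes of degree `> d`. -/
theorem IsRPiSigmaExt.regularAt_and_eq_zero_of_sub_eq (hE : IsRPiSigmaExt σ σE kind t)
    (hsimple : IsSimpleExt (RatFunc F) σE kind t) (hx : ExtXDegLE σ σE d kind t)
    (hσ : IsPiSigmaFieldExt σ₀ σ) {r : ℕ} {q : Fin r → F[X]} (hq : Function.Injective q)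
    (hQ : IsDXSet σ d (Set.range q)) {v a : E} {b : F[X]} {R : Fin r → E} {μ : Fin r → ℕ}
    (hv : σE v - v = (∑ i, polyDiv (R i) (q i ^ μ i)) + polyDiv a b)
    (ha : IsPolyElem F kind t a) (hb : PolyXDegLE σ d b)
    (hR : ∀ i n, ∃ w : F[X], w.degree < ((μ i * (q i).natDegree : ℕ) : WithBot ℕ) ∧
      powCoeffs (RatFunc F) kind t (R i) n = algebraMap F[X] (RatFunc F) w) :
    (∀ p, IsAperiodicPrime σ d p → RegularAt kind t p v) ∧ ∀ i, R i = 0 := by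
  classical
  obtain ⟨τ, hτ, hdeg⟩ := hσ.exists_polyAut
  have hqp : ∀ i, IsAperiodicPrime σ d (q i) := fun i =>
    ⟨hQ.irreducible _ ⟨i, rfl⟩, hQ.lt_natDegree _ ⟨i, rfl⟩, hQ.period_eq_zero _ ⟨i, rfl⟩⟩
  have hequiv : ∀ i j (k : ℤ), Associated ((τ ^ k) (q i)) (q j) → i = j := by
    intro i j k h
    by_contra hij
    exact hQ.coprime ⟨i, rfl⟩ ⟨j, rfl⟩ (hq.ne hij) ⟨k, (exists_zpow_div_eq_C_iff hτ k
      (hqp i).irreducible.ne_zero (hqp j).irreducible.ne_zero).mpr h⟩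
  have hRp : ∀ i, IsPolyElem F kind t (R i) := fun i n => by
    obtain ⟨w, -, hw⟩ := hR i n
    exact ⟨w, hw.symm⟩
  have hab : ∀ p, IsAperiodicPrime σ d p → RegularAt kind t p (polyDiv a b) :=
    fun p hp => ha.regularAt_polyDiv hE (polyXDegLE_iff.mp hb p hp)
  have hRreg : ∀ i p, Irreducible p → ¬ Associated p (q i) →
      RegularAt kind t p (polyDiv (R i) (q i ^ μ i)) := by
    intro i p hp h
    refine (hRp i).regularAt_polyDiv hE fun hd => h ?_
    exact hp.associated_of_dvd (hqp i).irreducible (hp.prime.dvd_of_dvd_pow hd)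
  have hpole : ∀ p, IsAperiodicPrime σ d p → ¬ RegularAt kind t p (σE v - v) →
      ∃ i, Associated p (q i) := by
    intro p hp h
    by_contra! hc
    refine h ?_
    rw [hv]
    exact (RegularAt.sum hE hp.irreducible.prime
      fun i _ => hRreg i p hp.irreducible (hc i)).add hE hp.irreducible.prime (hab p hp)
  have hreg : ∀ p, IsAperiodicPrime σ d p → RegularAt kind t p v := by
    intro p hp
    refine hE.regularAt_of_orbit hsimple hx hτ hdeg hp fun j k hj hk => ?_
    obtain ⟨i, hi⟩ := hpole _ (hp.zpow hτ hdeg j) hj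
    obtain ⟨i', hi'⟩ := hpole _ (hp.zpow hτ hdeg k) hk
    -- Two poles in one orbit make `q i` and `q i'` equivalent, hence equal by `σ`-coprimality;
    -- aperiodicity then gives `j = k`.
    have h1 : Associated ((τ ^ (k - j)) (q i)) (q i') := by
      have h2 := hi.symm.map ((τ ^ (k - j) : RingAut F[X]) : F[X] →* F[X])
      simp only [MonoidHom.coe_coe, zpow_apply_zpow_apply, sub_add_cancel] at h2
      exact h2.trans hi'
    obtain rfl := hequiv _ _ _ h1
    exact hp.associated_zpow hτ (hi.trans hi'.symm)
  refine ⟨hreg, fun i => ?_⟩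
  have hqi := (hqp i).irreducible.prime
  have h1 : RegularAt kind t (q i) (polyDiv (R i) (q i ^ μ i)) := by
    -- Every term on the right is regular at `q i`; for `σE v` this uses regularity of `v` at the
    -- preceding prime `τ⁻¹ (q i)`.
    have h2 : polyDiv (R i) (q i ^ μ i) = σE v - v - polyDiv a b -
        ∑ j ∈ Finset.univ.erase i, polyDiv (R j) (q j ^ μ j) := by
      rw [hv, ← Finset.add_sum_erase _ _ (Finset.mem_univ i)]
      ring
    have h3 : RegularAt kind t (q i) (σE v) := by
      obtain ⟨p, hp, hpq⟩ : ∃ p, IsAperiodicPrime σ d p ∧ τ p = q i := by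
        refine ⟨_, (hqp i).zpow hτ hdeg (-1), ?_⟩
        have := zpow_apply_zpow_apply (τ := τ) 1 (-1) (q i)
        rw [zpow_one, add_neg_cancel, zpow_zero] at this
        exact this
      rw [← hpq]
      exact (hE.regularAt_map_iff hsimple hx hτ hp (by rw [hpq]; exact hqp i) v).mpr (hreg _ hp)
    rw [h2]
    refine ((h3.sub hE hqi (hreg _ (hqp i))).sub hE hqi (hab _ (hqp i))).sub hE hqi
      (RegularAt.sum hE hqi fun j hj => hRreg j _ (hqp i).irreducible fun hass => ?_)
    exact Finset.ne_of_mem_erase hj (hequiv i j 0 (by rw [zpow_zero]; exact hass)).symm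
  rw [← hE.powCoeffs_eq_zero_iff]
  ext n
  obtain ⟨w, hw, hwn⟩ := hR i n
  obtain ⟨y, z, hz, hyz⟩ := (not_dvd_denom_iff _).mp (h1 n)
  have hq0 : algebraMap F[X] (RatFunc F) (q i ^ μ i) ≠ 0 :=
    RatFunc.algebraMap_ne_zero (pow_ne_zero _ (hqp i).irreducible.ne_zero)
  rw [polyDiv, hE.powCoeffs_smul, Finsupp.smul_apply, smul_eq_mul, hwn, mul_assoc,
    inv_mul_eq_iff_eq_mul₀ hq0, ← map_mul, ← map_mul] at hyz
  -- Regularity of `w / q i ^ μ i` provides a denominator `z` prime to `q i`, so the full power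
  -- divides `w`, which has smaller degree.
  have h2 : q i ^ μ i ∣ w := by
    have h3 : IsCoprime (q i ^ μ i) z :=
      (((hqp i).irreducible.coprime_iff_not_dvd).mpr hz).pow_left
    exact h3.dvd_of_dvd_mul_right ⟨y, RatFunc.algebraMap_injective F hyz⟩
  have h3 : w = 0 := by
    refine eq_zero_of_dvd_of_degree_lt h2 ?_
    rwa [degree_eq_natDegree (pow_ne_zero _ (hqp i).irreducible.ne_zero), natDegree_pow]
  rw [hwn, h3, map_zero]; rfl

theorem IsPolyElem.exists_degree_lt {f : E} (hf : IsPolyElem F kind t f) {N : ℕ}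
    (hN : xDegree F kind t f < (N : WithBot ℕ)) (n : Fin e → ℤ) :
    ∃ w : F[X], w.degree < (N : WithBot ℕ) ∧
      powCoeffs (RatFunc F) kind t f n = algebraMap F[X] (RatFunc F) w := by
  obtain ⟨w, hw⟩ := hf n
  refine ⟨w, ?_, hw.symm⟩
  by_cases hn : n ∈ (powCoeffs (RatFunc F) kind t f).support
  · refine lt_of_le_of_lt ?_ hN
    have h1 : (powCoeffs (RatFunc F) kind t f n).num.degree ≤ xDegree F kind t f :=
      Finset.le_sup (f := fun n => (powCoeffs (RatFunc F) kind t f n).num.degree) hn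
    rwa [← hw, RatFunc.num_algebraMap] at h1
  · rw [Finsupp.notMem_support_iff] at hn
    have h0 : w = 0 := RatFunc.algebraMap_injective F (by rw [hw, hn, map_zero])
    rw [h0, degree_zero]
    exact WithBot.bot_lt_coe N

theorem polyDiv_pow_eq {v : F[X]} (hv : v ≠ 0) (f : E) {m n : ℕ} (hmn : m ≤ n) :
    polyDiv f (v ^ m) = polyDiv (algebraMap F[X] (RatFunc F) (v ^ (n - m)) • f) (v ^ n) := by
  have h : algebraMap F[X] (RatFunc F) v ≠ 0 := RatFunc.algebraMap_ne_zero hv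
  unfold polyDiv
  rw [smul_smul]
  congr 1
  obtain ⟨k, rfl⟩ := Nat.exists_eq_add_of_le hmn
  rw [Nat.add_sub_cancel_left, map_pow, map_pow, map_pow, pow_add]
  field_simp

end Regular

/-! ### Degree bound after passing to a common denominator -/

section Degree

variable {F : Type*} [Field F] {E : Type*} [CommRing E] [Algebra (RatFunc F) E] {e : ℕ}
  {σ : RingAut (RatFunc F)} {σE : RingAut E} {kind : Fin e → MonomialKind} {t : Fin e → E}

/-- Extending a proper fraction by a power of `v` keeps it proper, and polynomials of degree below
`N * v.natDegree` form an `F`-space. Coefficient extraction is linear, so this can be checked for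
one exponent vector `k` at a time. -/
theorem IsRPiSigmaExt.exists_degree_lt_sub_sum (hE : IsRPiSigmaExt σ σE kind t) {v : F[X]}
    (hv : v.Monic) {ι : Type*} [Fintype ι] {N n : ℕ} {m : ι → ℕ} (hn : n ≤ N)
    (hm : ∀ j, m j ≤ N) {p : E} {P : ι → E} (hp : IsPolyElem F kind t p)
    (hpd : xDegree F kind t p < (n * v.natDegree : ℕ)) (hP : ∀ j, IsPolyElem F kind t (P j))
    (hPd : ∀ j, xDegree F kind t (P j) < (m j * v.natDegree : ℕ)) (c : ι → F)
    (k : Fin e → ℤ) :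
    ∃ w : F[X], w.degree < ((N * v.natDegree : ℕ) : WithBot ℕ) ∧
      powCoeffs (RatFunc F) kind t (algebraMap F[X] (RatFunc F) (v ^ (N - n)) • p -
        ∑ j, (RatFunc.C (c j) * algebraMap F[X] (RatFunc F) (v ^ (N - m j))) • P j) k =
        algebraMap F[X] (RatFunc F) w := by
  let φ : E →+ RatFunc F := AddMonoidHom.mk' (fun f => powCoeffs (RatFunc F) kind t f k)
    fun f g => by rw [hE.powCoeffs_add]; rfl
  have hφ : ∀ (y : RatFunc F) (f : E), φ (y • f) = y * φ f := fun y f => by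
    change powCoeffs (RatFunc F) kind t (y • f) k = _
    rw [hE.powCoeffs_smul]; rfl
  have hdeg : ∀ (w : F[X]) (i : ℕ), i ≤ N → w.degree < ((i * v.natDegree : ℕ) : WithBot ℕ) →
      v ^ (N - i) * w ∈ degreeLT F (N * v.natDegree) := by
    intro w i hi hw
    rw [mem_degreeLT]
    rcases eq_or_ne w 0 with rfl | hw0
    · rw [mul_zero, degree_zero]; exact WithBot.bot_lt_coe _
    · rw [degree_eq_natDegree hw0, Nat.cast_lt] at hw
      rw [degree_eq_natDegree (mul_ne_zero (pow_ne_zero _ hv.ne_zero) hw0),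
        natDegree_mul (pow_ne_zero _ hv.ne_zero) hw0, natDegree_pow, Nat.cast_lt]
      obtain ⟨z, rfl⟩ := Nat.exists_eq_add_of_le hi
      rw [Nat.add_sub_cancel_left, add_mul]
      omega
  obtain ⟨w, hw, hwp⟩ := hp.exists_degree_lt hpd k
  choose W hW hWP using fun j => (hP j).exists_degree_lt (hPd j) k
  refine ⟨v ^ (N - n) * w - ∑ j, c j • (v ^ (N - m j) * W j), ?_, ?_⟩
  · rw [← mem_degreeLT]
    exact sub_mem (hdeg w n hn hw)
      (Submodule.sum_mem _ fun j _ => Submodule.smul_mem _ _ (hdeg (W j) (m j) (hm j) (hW j)))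
  · change φ _ = _
    rw [map_sub, map_sum, map_sub, map_sum]
    simp only [hφ]
    congr 1
    · rw [map_mul]; exact congrArg _ hwp
    · refine Finset.sum_congr rfl fun j _ => ?_
      rw [smul_eq_C_mul, map_mul, map_mul, RatFunc.algebraMap_C, mul_assoc]
      exact congrArg (fun z => _ * (_ * z)) (hWP j)

end Degree

/-! ### The equivalence and the explicit solution -/

theorem mainTheorem3 {F : Type*} [Field F] [CharZero F]
    {E : Type*} [CommRing E] [Algebra (RatFunc F) E] {S : Type*} [CommRing S] [Algebra E S]
    -- the difference fields `(F, σ₀)`, `(F(x), σ)` and the difference rings `(E, σE)`, `(S, σS)`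
    (σ₀ : RingAut F) (σ : RingAut (RatFunc F)) (σE : RingAut E) (σS : RingAut S)
    (hσ : IsPiSigmaFieldExt σ₀ σ)
    (d r : ℕ) (q : Fin r → F[X]) (hq : Function.Injective q) (hQ : IsDXSet σ d (Set.range q))
    -- `S` is a `(d, x, Q)`-reduced extension of `F(x)`
    {e : ℕ} (kind : Fin e → MonomialKind) (t : Fin e → E)
    (l : Fin r → ℕ) (m : ∀ i, Fin (l i) → ℕ) (P : ∀ i, Fin (l i) → E) (s : ∀ i, Fin (l i) → S)
    (hS : IsReducedExt σ σE σS d kind t q l m P s)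
    -- `f = σ(g) - g + f'` with `f'` in `σ`-reduced form
    (f g f' : E) (hf : σE g - g + f' = f)
    (n : Fin r → ℕ) (p : Fin r → E) (a : E) (b : F[X])
    (hf' : IsSigmaReducedForm σ d kind t q f' n p a b)
    -- `μᵢ = max(nᵢ, mᵢ₁, …, mᵢₗ)`
    (μ : Fin r → ℕ) (hμ : ∀ i, μ i = max (n i) (Finset.univ.sup (m i))) :
    ((∃ h : S, σS h - h = algebraMap E S f) ↔
      (∀ i, ∃ c : Fin (l i) → F, (∀ j, σ₀ (c j) = c j) ∧
        algebraMap F[X] (RatFunc F) (q i ^ (μ i - n i)) • p i =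
          ∑ j, (RatFunc.C (c j) * algebraMap F[X] (RatFunc F) (q i ^ (μ i - m i j))) • P i j) ∧
      ∃ g' : E, σE g' - g' = polyDiv a b) ∧
    ∀ (c : ∀ i, Fin (l i) → F) (g' : E), (∀ i j, σ₀ (c i j) = c i j) →
      (∀ i, algebraMap F[X] (RatFunc F) (q i ^ (μ i - n i)) • p i =
        ∑ j, (RatFunc.C (c i j) *
          algebraMap F[X] (RatFunc F) (q i ^ (μ i - m i j))) • P i j) →
      σE g' - g' = polyDiv a b →
      PolyXDegLE σ d (den (F := F) kind t g') ∧
      ∀ h : S, h = algebraMap E S (g + g') +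
          ∑ i, ∑ j, algebraMap E S (algebraMap (RatFunc F) E (RatFunc.C (c i j))) * s i j →
        σS h - h = algebraMap E S f := by
  have hE := hS.isRPiSigmaExt
  have hSig := hS.isSigmaExt
  have hμn : ∀ i, n i ≤ μ i := fun i => hμ i ▸ le_max_left _ _
  have hμm : ∀ i j, m i j ≤ μ i := fun i j =>
    (Finset.le_sup (f := m i) (Finset.mem_univ j)).trans (hμ i ▸ le_max_right _ _)
  have hq0 : ∀ i, q i ≠ 0 := fun i => (hQ.irreducible _ ⟨i, rfl⟩).ne_zero
  have hσF : ∀ c : F, σ₀ c = c → σE (algebraMap (RatFunc F) E (RatFunc.C c)) =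
      algebraMap (RatFunc F) E (RatFunc.C c) := fun c hc => by
    rw [hE.map_algebraMap, hσ.map_C, hc]
  -- the two ways to write the `Q`-contributions
  have hsum : ∀ (c : ∀ i, Fin (l i) → F) (i : Fin r),
      polyDiv (p i) (q i ^ n i) -
        ∑ j, algebraMap (RatFunc F) E (RatFunc.C (c i j)) * polyDiv (P i j) (q i ^ m i j) =
      polyDiv (algebraMap F[X] (RatFunc F) (q i ^ (μ i - n i)) • p i -
        ∑ j, (RatFunc.C (c i j) *
          algebraMap F[X] (RatFunc F) (q i ^ (μ i - m i j))) • P i j) (q i ^ μ i) := by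
    intro c i
    rw [polyDiv_pow_eq (hq0 i) (p i) (hμn i)]
    simp only [polyDiv_pow_eq (hq0 i) _ (hμm i _)]
    unfold polyDiv
    rw [smul_sub, Finset.smul_sum]
    congr 1
    refine Finset.sum_congr rfl fun j _ => ?_
    rw [← Algebra.smul_def, smul_smul, smul_smul, smul_smul]
    congr 1
    ring
  have hdegree : ∀ (i : Fin r) (c : Fin (l i) → F) (k : Fin e → ℤ), ∃ w : F[X],
      w.degree < ((μ i * (q i).natDegree : ℕ) : WithBot ℕ) ∧
      powCoeffs (RatFunc F) kind t (algebraMap F[X] (RatFunc F) (q i ^ (μ i - n i)) • p i -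
        ∑ j, (RatFunc.C (c j) *
          algebraMap F[X] (RatFunc F) (q i ^ (μ i - m i j))) • P i j) k =
        algebraMap F[X] (RatFunc F) w := by
    intro i c k
    exact hE.exists_degree_lt_sub_sum (hQ.monic _ ⟨i, rfl⟩) (hμn i) (hμm i)
      (hf'.isPolyElem_p i) (by rw [mul_comm]; exact hf'.degree_lt i) (hS.isPolyElem i)
      (hS.degree_lt i) c k
  have hden : ∀ v : E, (∀ p, IsAperiodicPrime σ d p → RegularAt kind t p v) →
      PolyXDegLE σ d (den (F := F) kind t v) := fun v hv => by
    rw [polyXDegLE_iff]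
    intro p hp
    rw [dvd_den_iff hp.irreducible.prime, not_not]
    exact hv p hp
  have hback : ∀ (c : ∀ i, Fin (l i) → F) (g' : E), (∀ i j, σ₀ (c i j) = c i j) →
      (∀ i, algebraMap F[X] (RatFunc F) (q i ^ (μ i - n i)) • p i =
        ∑ j, (RatFunc.C (c i j) *
          algebraMap F[X] (RatFunc F) (q i ^ (μ i - m i j))) • P i j) →
      σE g' - g' = polyDiv a b → ∀ h : S, h = algebraMap E S (g + g') +
          ∑ i, ∑ j, algebraMap E S (algebraMap (RatFunc F) E (RatFunc.C (c i j))) * s i j →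
        σS h - h = algebraMap E S f := by
    rintro c g' hc hcP hg' h rfl
    have h1 : ∀ i, polyDiv (p i) (q i ^ n i) =
        ∑ j, algebraMap (RatFunc F) E (RatFunc.C (c i j)) * polyDiv (P i j) (q i ^ m i j) := by
      intro i
      rw [← sub_eq_zero, hsum, hcP i, sub_self, polyDiv, smul_zero]
    have h2 : ∑ i, ∑ j, σS (algebraMap E S (algebraMap (RatFunc F) E (RatFunc.C (c i j))) *
        s i j) = (∑ i, ∑ j, algebraMap E S (algebraMap (RatFunc F) E (RatFunc.C (c i j))) *
        s i j) + algebraMap E S (∑ i, polyDiv (p i) (q i ^ n i)) := by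
      simp only [h1, map_sum, ← Finset.sum_add_distrib]
      refine Finset.sum_congr rfl fun i _ => Finset.sum_congr rfl fun j _ => ?_
      rw [map_mul, hSig.map_algebraMap, hσF _ (hc i j), hS.map_s, mul_add, map_mul]
    have h3 : σS (algebraMap E S (g + g')) = algebraMap E S (g + g') +
        algebraMap E S (σE g - g) + algebraMap E S (polyDiv a b) := by
      rw [hSig.map_algebraMap, ← hg', ← map_add, ← map_add, map_add]
      congr 1
      ring
    rw [← hf, hf'.eq, map_add σS, map_sum σS]
    simp only [map_sum σS]
    rw [h2, h3]
    simp only [map_add]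
    ring
  refine ⟨⟨?_, ?_⟩, fun c g' hc hcP hg' => ⟨?_, hback c g' hc hcP hg'⟩⟩
  · rintro ⟨h, hh⟩
    -- Characteristic 0 enters here.
    let _ : Algebra ℚ E := ((algebraMap (RatFunc F) E).comp (algebraMap ℚ (RatFunc F))).toAlgebra
    obtain ⟨c, w, hc, rfl⟩ := hSig.exists_eq_sum hh
    -- Constants descend twice: from `E` to `F(x)`, then from `F(x)` to `F`.
    have hcF : ∀ j, ∃ c₀ : F, σ₀ c₀ = c₀ ∧ c j = algebraMap (RatFunc F) E (RatFunc.C c₀) := by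
      intro j
      obtain ⟨y, hy⟩ := hE.const _ (hc j)
      have h1 := hc j
      rw [hy, hE.map_algebraMap] at h1
      obtain ⟨c₀, rfl⟩ := hσ.const y (hE.injective h1)
      refine ⟨c₀, RatFunc.C_injective ?_, hy⟩
      rw [← hσ.map_C]
      exact hE.injective h1
    choose c₀ hc₀ hcc using hcF
    -- The generators `s` cancel in `σ(h) - h`, so the identity already holds in `E`.
    have hsub : σE (w - g) - (w - g) = (∑ i, polyDiv (algebraMap F[X] (RatFunc F)
        (q i ^ (μ i - n i)) • p i - ∑ j, (RatFunc.C (c₀ ⟨i, j⟩) *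
          algebraMap F[X] (RatFunc F) (q i ^ (μ i - m i j))) • P i j) (q i ^ μ i)) +
        polyDiv a b := by
      simp only [← hsum fun i j => c₀ ⟨i, j⟩]
      apply hSig.algebraicIndependent.algebraMap_injective
      have h1 : σS (∑ j : (Σ i, Fin (l i)), algebraMap E S (c j) * s j.1 j.2) =
          (∑ j : (Σ i, Fin (l i)), algebraMap E S (c j) * s j.1 j.2) +
          algebraMap E S (∑ i, ∑ j, algebraMap (RatFunc F) E (RatFunc.C (c₀ ⟨i, j⟩)) *
            polyDiv (P i j) (q i ^ m i j)) := by
        rw [← Fintype.sum_sigma' (fun i j => algebraMap (RatFunc F) E (RatFunc.C (c₀ ⟨i, j⟩)) *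
            polyDiv (P i j) (q i ^ m i j)), map_sum, map_sum, ← Finset.sum_add_distrib]
        refine Finset.sum_congr rfl fun j _ => ?_
        rw [map_mul, hSig.map_algebraMap, hc, hS.map_s, mul_add, map_mul (algebraMap E S), hcc]
      rw [map_add, h1, hSig.map_algebraMap, ← hf, hf'.eq] at hh
      simp only [Finset.sum_sub_distrib]
      simp only [map_add, map_sub] at hh ⊢
      linear_combination hh
    obtain ⟨-, hR⟩ := hE.regularAt_and_eq_zero_of_sub_eq hS.isSimpleExt hS.extXDegLE hσ hq hQ
      hsub hf'.isPolyElem hf'.xDegLE fun i => hdegree i _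
    refine ⟨fun i => ⟨fun j => c₀ ⟨i, j⟩, fun j => hc₀ _, sub_eq_zero.mp (hR i)⟩, w - g, ?_⟩
    rw [hsub]
    simp only [hR, polyDiv, smul_zero, Finset.sum_const_zero, zero_add]
  · rintro ⟨hc, g', hg'⟩
    choose c hc hcP using hc
    exact ⟨_, hback c g' hc hcP hg' _ rfl⟩
  -- With `R = 0` and `μ = 0` the strict bound reads `degree 0 < 0`, true because the zero
  -- polynomial has degree `⊥`.
  · refine hden g' (hE.regularAt_and_eq_zero_of_sub_eq (R := fun _ => 0) (μ := fun _ => 0)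
      hS.isSimpleExt hS.extXDegLE hσ hq hQ ?_ hf'.isPolyElem hf'.xDegLE fun i k => ?_).1
    · simpa [polyDiv] using hg'
    · refine ⟨0, ?_, ?_⟩
      · rw [degree_zero]; exact WithBot.bot_lt_coe _
      · rw [hE.powCoeffs_eq_zero_iff.mpr rfl, map_zero]; rfl
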